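/- **Coordinates.** Let $\mathbb R^3$ have Euclidean coordinates $\nu=(\nu_1,\nu_2,\nu_3)$, obtained from the usual ones by the orthogonal change $\nu_1=(\xi_3-\xi_2)/\sqrt2$, $\nu_2=\xi_1$, $\nu_3=(\xi_3+\xi_2)/\sqrt2$; the light cone $\xi_1^2+\xi_2^2=\xi_3^2$ becomes $2\nu_1\nu_3=\nu_2^2$. **Sectors.** For $K\ge10$ let $$\Gamma_{1/K}=\{2\nu_1\nu_3=\nu_2^2,\ 1-\tfrac1K\le\nu_3\le1,\ |\nu_2/\nu_3|\le1\}.$$ For $0<s\le1$ and $\eta\in[-1,1]$ let $\Lambda(\eta,s)=\{\nu\in\Gamma_{1/K}:|\nu_2/\nu_3-\eta|\le s\}$, and let the sector $\tau$ with centre $\eta$ and aperture $s$ be the closed $s^2$-neighbourhood of $\Lambda(\eta,s)$. Let $\mathbf S_s$ be the set of sectors of aperture $s$ whose centres are the points $(1-s)(2j/N-1)$, $0\le j\le N$, $N=\lceil10/s\rceil$ (so $\mathbf S_1$ has one element, with centre $0$). **Boxes and balls.** For $\eta\in[-1,1]$ let $\xi$ be the point of the cone with $\xi_3=1$ and $\nu_2/\nu_3=\eta$,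 and (in the $\xi$-coordinates) $\mathbf c=(\xi_1,\xi_2,1)$, $\mathbf n=(\xi_1,\xi_2,-1)$, $\mathbf t=(-\xi_2,\xi_1,0)$. For the sector $\tau$ with centre $\eta$ and aperture $s$ let $$U_{\tau,R}=\{x:\ |\mathbf c\cdot x|\le Rs^2,\ |\mathbf n\cdot x|\le R,\ |\mathbf t\cdot x|\le Rs\};$$ $\sum_{U/\!/U_{\tau,R}}$ is the sum over the tiling of $\mathbb R^3$ by the translates of $U_{\tau,R}$ by the lattice generated by its edge vectors. $\sum_{B_r}$ is the sum over the balls of radius $r$ with centres in $r\mathbb Z^3$. **Pieces.** Let $1\le r\le R$ and let $f$ be a Schwartz function with $\operatorname{supp}\hat f$ in the closed $R^{-1}$-neighbourhood $N_{R^{-1}}(\Gamma_{1/K})$. Take any Schwartz functions $f_\theta$, $\theta\in\mathbf S_{R^{-1/2}}$, with $\operatorname{supp}\hat f_\theta\subset\theta$ and $f=\sum_\theta f_\theta$. For each $s\in[R^{-1/2},1]$ assign, in any way, to each $\theta\in\mathbf S_{R^{-1/2}}$ exactly one $\tau\in\mathbf S_s$ with $\theta\cap\tau\ne\emptyset$ (for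 $s=R^{-1/2}$, $\theta$ itself), and write $\theta\subset\tau$ if $\theta$ is assigned to $\tau$. Put $f_\tau=\sum_{\theta\subset\tau}f_\theta$ and $$S_{B_r}f=\Big(\sum_{\tau\in\mathbf S_{r^{-1/2}}}|f_\tau|^2\Big)^{1/2}\Big|_{B_r},\qquad S_Uf=\Big(\sum_{\theta\in\mathbf S_{R^{-1/2}},\,\theta\subset\tau}|f_\theta|^2\Big)^{1/2}\Big|_U\quad\text{for } U/\!/U_{\tau,R}.$$ **The constant.** $S_K(r,R)\in[0,\infty]$ is the smallest constant such that for all such $f$, $(f_\theta)$ and assignments $$\sum_{B_r}|B_r|^{-1}\|S_{B_r}f\|_{L^2(B_r)}^4\le S_K(r,R)\sum_{\substack{R^{-1/2}\le s\le1\\ s\ \mathrm{dyadic}}}\ \sum_{\tau\in\mathbf S_s}\ \sum_{U/\!/U_{\tau,R}}|U|^{-1}\|S_Uf\|_{L^2(U)}^4 .$$ **Lemma.** There is an absolute constant $C$ such that for all $K\ge10$ and all $1\le r_1<r_2\le r_3$, $$S_K(r_1,r_3)\le C\,(1+\log r_2)\;S_K(r_1,r_2)\max_{\substack{r_2^{-1/2}\le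 s\le1\\ s\ \mathrm{dyadic}}}S_K(s^2r_2,s^2r_3),$$ where dyadic means $s=2^{-k}$, $k=0,1,2,\dots$. In particular the factor $C(1+\log r_2)$ may be replaced by $3C\log r_2$ when $r_2\ge2$. -/

import Mathlib

open MeasureTheory
open scoped ENNReal NNReal FourierTransform SchwartzMap RealInnerProductSpace

noncomputable section

/-- `ℝ³` with its Euclidean norm. Throughout we use the coordinates `ν₁ = x 0`, `ν₂ = x 1`,
`ν₃ = x 2`, related to the usual ones by the orthogonal change of variables
`ν₁ = (ξ₃ - ξ₂) / √2`, `ν₂ = ξ₁`, `ν₃ = (ξ₃ + ξ₂) / √2`; the light cone `ξ₁² + ξ₂² = ξ₃²`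
becomes `2 ν₁ ν₃ = ν₂²`. -/
abbrev E3 : Type := EuclideanSpace ℝ (Fin 3)

/-- The short truncated cone `Γ_{1/K}`. -/
def coneArc (K : ℝ) : Set E3 :=
  {x | 2 * x 0 * x 2 = x 1 ^ 2 ∧ 1 - 1 / K ≤ x 2 ∧ x 2 ≤ 1 ∧ |x 1 / x 2| ≤ 1}

/-- The surface sector `Λ(η, s)` of `Γ_{1/K}` with centre `η` and aperture `s`. -/
def surfaceSector (K η s : ℝ) : Set E3 :=
  {x | x ∈ coneArc K ∧ |x 1 / x 2 - η| ≤ s}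

/-- The sector `τ` of `Γ_{1/K}` with centre `η` and aperture `s`: the `s²`-neighbourhood of the
surface sector, a set comparable to a rectangular box containing `Λ(η, s)`, with thickness `s²` in
the normal direction and width `s` in the tangential direction. -/
def sector (K η s : ℝ) : Set E3 :=
  Metric.cthickening (s ^ 2) (surfaceSector K η s)

/-- The centres of the sectors in the collection `𝐒_s`: about `10 s⁻¹` evenly spaced points of
`[-(1 - s), 1 - s]`, the range of `η` for which `[η - s, η + s] ⊆ [-1, 1]`. For `s = 1` there is
only one sector, which corresponds to all of `Γ_{1/K}`. -/
def sectorCenters (s : ℝ) : Finset ℝ :=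
  (Finset.range (⌈10 / s⌉₊ + 1)).image fun j : ℕ => (1 - s) * (2 * (j : ℝ) / (⌈10 / s⌉₊ : ℝ) - 1)

/-- The aperture `ρ^{-1/2}` that belongs to the spatial scale `ρ`. -/
def aperture (ρ : ℝ) : ℝ := ρ ^ (-(1 / 2) : ℝ)

/-- The dyadic numbers `s` with `R^{-1/2} ≤ s ≤ 1`. -/
def dyadicScales (R : ℝ) : Set ℝ :=
  {s | (∃ k : ℕ, s = (1 / 2 : ℝ) ^ k) ∧ aperture R ≤ s}

/-- The core line direction `𝐜(ξ) = (ξ₁, ξ₂, 1)` in the coordinates `ν`, where `ξ` is the point of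
the cone at height `ξ₃ = 1` with `ν₂ / ν₃ = η`. -/
def coreDir (η : ℝ) : E3 := (√2 / (1 + η ^ 2 / 2)) • !₂[η ^ 2 / 2, η, 1]

/-- The normal direction `𝐧(ξ) = (ξ₁, ξ₂, -1)` in the coordinates `ν`. -/
def normalDir (η : ℝ) : E3 := (√2 / (1 + η ^ 2 / 2)) • !₂[-1, η, -(η ^ 2 / 2)]

/-- The tangent direction `𝐭(ξ) = (-ξ₂, ξ₁, 0)` in the coordinates `ν`. -/
def tangentDir (η : ℝ) : E3 := (1 / (1 + η ^ 2 / 2)) • !₂[-η, η ^ 2 / 2 - 1, η]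

/-- The box `U_{τ,ρ}` for the sector `τ` with centre `η` and aperture `s`. -/
def boxU (η s ρ : ℝ) : Set E3 :=
  {x | |⟪coreDir η, x⟫| ≤ ρ * s ^ 2 ∧ |⟪normalDir η, x⟫| ≤ ρ ∧ |⟪tangentDir η, x⟫| ≤ ρ * s}

/-- The translates of `U_{τ,ρ}` which tile `ℝ³`, indexed by `ℤ³`. The translation vectors are
multiples of the edges of the box: `𝐜` and `𝐧` have length `√2`, and `𝐭` has length `1`. -/
def tileU (η s ρ : ℝ) (k : Fin 3 → ℤ) : Set E3 :=
  {x | x - ((k 0 * (ρ * s ^ 2)) • coreDir η + (k 1 * ρ) • normalDir η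
    + (2 * k 2 * (ρ * s)) • tangentDir η) ∈ boxU η s ρ}

/-- The balls `B_r` of a finitely overlapping cover of `ℝ³`: radius `r`, centres in `r ℤ³`. -/
def coverBall (r : ℝ) (k : Fin 3 → ℤ) : Set E3 :=
  Metric.closedBall (!₂[r * k 0, r * k 1, r * k 2]) r

/-- `f = ∑ f_θ`, summed over the sectors `θ ∈ 𝐒_{R^{-1/2}}`, and the Fourier transform of each
`f_θ` is supported on `θ`. The sector `θ` with centre `η` has the piece `g η`. -/
def IsSectorDecomposition (K R : ℝ) (f : 𝓢(E3, ℂ)) (g : ℝ → 𝓢(E3, ℂ)) : Prop :=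
  (∀ η ∈ sectorCenters (aperture R), tsupport (𝓕 (g η) : 𝓢(E3, ℂ)) ⊆ sector K η (aperture R)) ∧
    f = ∑ η ∈ sectorCenters (aperture R), g η

/-- A meaning of `θ ⊂ τ` for `θ ∈ 𝐒_{R^{-1/2}}` and `τ ∈ 𝐒_s`: for every aperture `s`, each `θ` is
assigned to exactly one `τ` among those that it meets. The sector of aperture `s` to which the
`θ` with centre `η` is assigned is the one with centre `par s η`; a sector of the finest aperture
`R^{-1/2}` is assigned to itself. -/
def IsSectorAssignment (K R : ℝ) (par : ℝ → ℝ → ℝ) : Prop :=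
  (∀ η ∈ sectorCenters (aperture R), par (aperture R) η = η) ∧
    ∀ s : ℝ, aperture R ≤ s → s ≤ 1 → ∀ η ∈ sectorCenters (aperture R),
      par s η ∈ sectorCenters s ∧
        (sector K η (aperture R) ∩ sector K (par s η) s).Nonempty

/-- The set `A(τ)` of the centres of the sectors `θ ∈ 𝐒_{R^{-1/2}}`, `θ ⊂ τ`, where `τ ∈ 𝐒_s` has
centre `η`. -/
def children (R : ℝ) (par : ℝ → ℝ → ℝ) (s η : ℝ) : Finset ℝ :=
  {θ ∈ sectorCenters (aperture R) | par s θ = η}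

/-- `f_τ = ∑_{θ ⊂ τ} f_θ`. -/
def sectorPiece (R : ℝ) (g : ℝ → 𝓢(E3, ℂ)) (par : ℝ → ℝ → ℝ) (s η : ℝ) : 𝓢(E3, ℂ) :=
  ∑ θ ∈ children R par s η, g θ

/-- The square function `(∑_{τ ∈ 𝐒_{r^{-1/2}}} |f_τ|²)^{1/2}`, whose restriction to a ball `B_r` is
`S_{B_r} f`. -/
def ballSquareFn (r R : ℝ) (g : ℝ → 𝓢(E3, ℂ)) (par : ℝ → ℝ → ℝ) (x : E3) : ℝ :=
  √(∑ η ∈ sectorCenters (aperture r), ‖sectorPiece R g par (aperture r) η x‖ ^ 2)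

/-- The square function `(∑_{θ ∈ 𝐒_{R^{-1/2}}, θ ⊂ τ} |f_θ|²)^{1/2}`, whose restriction to a
translate `U` of `U_{τ,R}` is `S_U f`; here `τ ∈ 𝐒_s` has centre `η`. -/
def boxSquareFn (R : ℝ) (g : ℝ → 𝓢(E3, ℂ)) (par : ℝ → ℝ → ℝ) (s η : ℝ) (x : E3) : ℝ :=
  √(∑ θ ∈ children R par s η, ‖g θ x‖ ^ 2)

/-- `|U|⁻¹ ‖S‖_{L²(U)}⁴`. -/
def normalizedL2 (U : Set E3) (S : E3 → ℝ) : ℝ≥0∞ :=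
  (volume U)⁻¹ * eLpNorm S 2 (volume.restrict U) ^ 4

/-- `∑_{B_r} |B_r|⁻¹ ‖S_{B_r} f‖_{L²(B_r)}⁴`. -/
def ballSum (r R : ℝ) (g : ℝ → 𝓢(E3, ℂ)) (par : ℝ → ℝ → ℝ) : ℝ≥0∞ :=
  ∑' k : Fin 3 → ℤ, normalizedL2 (coverBall r k) (ballSquareFn r R g par)

/-- `∑_{R^{-1/2} ≤ s ≤ 1} ∑_{τ ∈ 𝐒_s} ∑_{U ∥ U_{τ,R}} |U|⁻¹ ‖S_U f‖_{L²(U)}⁴`. -/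
def boxSum (R : ℝ) (g : ℝ → 𝓢(E3, ℂ)) (par : ℝ → ℝ → ℝ) : ℝ≥0∞ :=
  ∑' s : dyadicScales R, ∑ η ∈ sectorCenters (s : ℝ),
    ∑' k : Fin 3 → ℤ, normalizedL2 (tileU η s R k) (boxSquareFn R g par s η)

/-- `S_K(r, R)`: the smallest constant for which the multiscale inequality holds for all Schwartz
functions `f` with Fourier support in the `R⁻¹`-neighbourhood of `Γ_{1/K}`, uniformly in the
choice of the pieces `f_θ` and of the assignment `θ ⊂ τ`. -/
def SK (K r R : ℝ) : ℝ≥0∞ :=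
  sInf {C : ℝ≥0∞ | ∀ (f : 𝓢(E3, ℂ)) (g : ℝ → 𝓢(E3, ℂ)) (par : ℝ → ℝ → ℝ),
    tsupport (𝓕 f : 𝓢(E3, ℂ)) ⊆ Metric.cthickening R⁻¹ (coneArc K) →
    IsSectorDecomposition K R f g → IsSectorAssignment K R par →
    ballSum r R g par ≤ C * boxSum R g par}

end

/-! ### Averages over translates of a parallelepiped -/

/-! The inequality at scales `(r₁, r₂)` is applied to the family regrouped at aperture `r₂^{-1/2}`.
It bounds the ball sum by boxes `U_{τ,r₂}`, with `τ` of dyadic aperture `s`. A Lorentz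
transformation carrying `τ` to the whole cone turns such a box into roughly a ball of radius `s²r₂`,
and sectors of aperture `r₃^{-1/2}` into sectors of aperture `(s²r₃)^{-1/2}`. The inequality at
scales `(s²r₂, s²r₃)` then applies inside `τ`. Undoing the transformation returns boxes of scale
`r₃`. For fixed `s`, different `τ` use disjoint sets of `θ`, and `∑ (∫ S_τ)² ≤ (∫ ∑ S_τ)²`, so
summing over `τ` costs nothing. Summing over the dyadic `s` costs the logarithm.

Three technical points shape the proof.

Tilings are neither rotated nor rescaled into one another exactly. Every sum `∑_U |U|⁻¹ (∫_U S)²` is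
therefore replaced by the translation-invariant `avgEnergy`, to which it is comparable. This
quantity changes by a constant when the box parameters do (`avgEnergy_boxMap_le`) and exactly under
linear maps (`avgEnergy_comp`). The boxes are written in the frame `γ, γ', γ''` of `γ(η) = (η²/2, η,
1)`, which Lorentz maps respect (`boxMap_comp_lorentzT`).

A sector `θ` need not lie inside a coarser sector, and for `r₂` near `r₃` there is no room for it.
An initial dilation of the ratio `ν₂/ν₃` by `1/2`, and the parameter `t = 2σ` instead of `σ` later,
halve the angular intervals. They then fit into one of the available sectors (`exists_sectorCenter`,
`tsupport_compLorentz_subset`).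

The given assignment `θ ⊂ τ` does not agree with one chosen after rescaling. The two labels of a
piece stay within a bounded number of sectors of each other, so the family splits into boundedly
many subfamilies on which one label determines the other (`exists_regrouping`,
`avgEnergy_labels_le`). -/

/-- The absolute value of the determinant, as an extended nonnegative real. -/
noncomputable def absDet (Φ : E3 →ₗ[ℝ] E3) : ℝ≥0∞ := ENNReal.ofReal |LinearMap.det Φ|

/-- The parallelepiped with centre `x` given by `|Φ (y - x)|_∞ ≤ m`. -/
def paral (Φ : E3 →ₗ[ℝ] E3) (m : ℝ) (x : E3) : Set E3 := {y | ∀ i, |Φ (y - x) i| ≤ m}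

/-- The translates of a set `Y`, given in the coordinates `Φ`, by the lattice `Φ⁻¹ ℤ³`. -/
def latticeTile (Φ : E3 →ₗ[ℝ] E3) (Y : Set (Fin 3 → ℝ)) (k : Fin 3 → ℤ) : Set E3 :=
  {x | (fun i => Φ x i - k i) ∈ Y}

/-- The half-open unit cube centred at the origin. -/
def unitCube : Set (Fin 3 → ℝ) := {y | ∀ i, -(1 / 2) ≤ y i ∧ y i < 1 / 2}

/-- The normalized `L²` norm of the averages of `S` over the translates of a parallelepiped. -/
noncomputable def avgEnergy (Φ : E3 →ₗ[ℝ] E3) (m : ℝ) (S : E3 → ℝ≥0∞) : ℝ≥0∞ :=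
  absDet Φ ^ 2 * ∫⁻ x, (∫⁻ y in paral Φ m x, S y) ^ 2

lemma ENNReal.sq_sum_le_card_mul_sum_sq {ι : Type*} (s : Finset ι) (f : ι → ℝ≥0∞) :
    (∑ i ∈ s, f i) ^ 2 ≤ s.card * ∑ i ∈ s, f i ^ 2 := by
  have := ENNReal.rpow_sum_le_const_mul_sum_rpow s f (p := 2) (by norm_num)
  norm_num at this
  exact_mod_cast this

lemma volume_setOf_forall_mem (T : Fin 3 → Set ℝ) :
    volume {x : E3 | ∀ i, x i ∈ T i} = ∏ i, volume (T i) := by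
  have h := (PiLp.volume_preserving_ofLp (Fin 3)).measure_preimage_equiv
    (f := (MeasurableEquiv.toLp 2 (Fin 3 → ℝ)).symm) (Set.pi Set.univ T)
  rw [volume_pi_pi] at h
  rw [← h]
  congr 1
  ext x
  simp [Set.mem_pi]

lemma absDet_ne_top (Φ : E3 →ₗ[ℝ] E3) : absDet Φ ≠ ⊤ := ENNReal.ofReal_ne_top

lemma absDet_ne_zero {Φ : E3 →ₗ[ℝ] E3} (h : LinearMap.det Φ ≠ 0) : absDet Φ ≠ 0 := by
  simp [absDet, h]

lemma absDet_mul_volume_preimage {Φ : E3 →ₗ[ℝ] E3} (h : LinearMap.det Φ ≠ 0) (s : Set E3) :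
    absDet Φ * volume (Φ ⁻¹' s) = volume s := by
  rw [Measure.addHaar_preimage_linearMap volume h, ← mul_assoc, absDet,
    ← ENNReal.ofReal_mul (abs_nonneg _), ← abs_mul, mul_inv_cancel₀ h]
  simp

lemma absDet_mul_volume_cell {Φ : E3 →ₗ[ℝ] E3} (h : LinearMap.det Φ ≠ 0) (k : Fin 3 → ℤ) :
    absDet Φ * volume (latticeTile Φ unitCube k) = 1 := by
  have h1 : latticeTile Φ unitCube k =
      Φ ⁻¹' {x : E3 | ∀ i, x i ∈ Set.Ico ((k i : ℝ) - 1 / 2) (k i + 1 / 2)} := by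
    ext x
    simp only [latticeTile, unitCube, Set.mem_ofPred_eq, Set.mem_preimage, Set.mem_Ico]
    refine forall_congr' fun i => ?_
    constructor <;> rintro ⟨h1, h2⟩ <;> constructor <;> linarith
  rw [h1, absDet_mul_volume_preimage h, volume_setOf_forall_mem]
  simp only [Real.volume_Ico]
  norm_num

lemma measurable_coord (Φ : E3 →ₗ[ℝ] E3) (i : Fin 3) : Measurable fun x => Φ x i := by
  have : Continuous Φ := Φ.continuous_of_finiteDimensional
  exact Continuous.measurable (by fun_prop)

lemma mem_cell_iff (Φ : E3 →ₗ[ℝ] E3) (k : Fin 3 → ℤ) (x : E3) :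
    x ∈ latticeTile Φ unitCube k ↔ ∀ i, ⌊Φ x i + 1 / 2⌋ = k i := by
  simp only [latticeTile, unitCube, Set.mem_ofPred_eq]
  refine forall_congr' fun i => ?_
  rw [Int.floor_eq_iff]
  constructor <;> rintro ⟨h1, h2⟩ <;> constructor <;> linarith

lemma measurableSet_cell (Φ : E3 →ₗ[ℝ] E3) (k : Fin 3 → ℤ) :
    MeasurableSet (latticeTile Φ unitCube k) := by
  have : latticeTile Φ unitCube k = ⋂ i, {x | ⌊Φ x i + 1 / 2⌋ = k i} := by
    ext x; simp [mem_cell_iff]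
  rw [this]
  refine MeasurableSet.iInter fun i => ?_
  exact (Int.measurable_floor.comp ((measurable_coord Φ i).add_const _)) (measurableSet_singleton _)

lemma lintegral_eq_tsum_cell (Φ : E3 →ₗ[ℝ] E3) (F : E3 → ℝ≥0∞) :
    ∫⁻ x, F x = ∑' k : Fin 3 → ℤ, ∫⁻ x in latticeTile Φ unitCube k, F x := by
  rw [← lintegral_iUnion (measurableSet_cell Φ)]
  · have : ⋃ k, latticeTile Φ unitCube k = Set.univ := by
      refine Set.eq_univ_of_forall fun x => Set.mem_iUnion.2 ⟨fun i => ⌊Φ x i + 1 / 2⌋, ?_⟩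
      rw [mem_cell_iff]; intro i; rfl
    rw [this, Measure.restrict_univ]
  · intro k l hkl
    refine Set.disjoint_left.2 fun x hx hx' => hkl ?_
    rw [mem_cell_iff] at hx hx'
    funext i
    rw [← hx i, hx' i]

/-- A sum over a lattice of tiles is controlled by the averages over parallelepipeds. -/
lemma tsum_tile_le_avgEnergy {Φ : E3 →ₗ[ℝ] E3} (h : LinearMap.det Φ ≠ 0) {Y : Set (Fin 3 → ℝ)}
    {ρ : ℝ} (hY : ∀ y ∈ Y, ∀ i, |y i| ≤ ρ) (S : E3 → ℝ≥0∞) :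
    absDet Φ * ∑' k, (∫⁻ y in latticeTile Φ Y k, S y) ^ 2 ≤ avgEnergy Φ (ρ + 1 / 2) S := by
  have h1 : ∀ k, (∫⁻ y in latticeTile Φ Y k, S y) ^ 2 ≤
      absDet Φ * ∫⁻ x in latticeTile Φ unitCube k, (∫⁻ y in paral Φ (ρ + 1 / 2) x, S y) ^ 2 := by
    intro k
    calc (∫⁻ y in latticeTile Φ Y k, S y) ^ 2
        = absDet Φ * ((∫⁻ y in latticeTile Φ Y k, S y) ^ 2
            * volume (latticeTile Φ unitCube k)) := by
          rw [mul_left_comm, absDet_mul_volume_cell h, mul_one]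
      _ = absDet Φ * ∫⁻ x in latticeTile Φ unitCube k,
            (∫⁻ y in latticeTile Φ Y k, S y) ^ 2 := by rw [setLIntegral_const]
      _ ≤ _ := by
          gcongr 1
          -- For `x` in the cell of `k`, the whole tile at `k` lies within `ρ + 1/2` of `x` in the
          -- coordinates `Φ`.
          refine setLIntegral_mono' (measurableSet_cell Φ k) fun x hx => ?_
          gcongr
          intro y hy i
          have h2 := hY _ hy i
          have h3 := hx i
          rw [map_sub, PiLp.sub_apply]
          rw [abs_le] at h2 ⊢
          constructor <;> linarith [h2.1, h2.2, h3.1, h3.2]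
  calc absDet Φ * ∑' k, (∫⁻ y in latticeTile Φ Y k, S y) ^ 2
      ≤ absDet Φ * ∑' k, absDet Φ * ∫⁻ x in latticeTile Φ unitCube k,
          (∫⁻ y in paral Φ (ρ + 1 / 2) x, S y) ^ 2 := by
        gcongr with k; exact h1 k
    _ = _ := by
        rw [ENNReal.tsum_mul_left, ← lintegral_eq_tsum_cell, avgEnergy, ← mul_assoc, sq]

lemma lintegral_biUnion_finset_le {ι α : Type*} [MeasurableSpace α] {μ : Measure α}
    (F : Finset ι) (t : ι → Set α) (S : α → ℝ≥0∞) :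
    ∫⁻ y in ⋃ l ∈ F, t l, S y ∂μ ≤ ∑ l ∈ F, ∫⁻ y in t l, S y ∂μ := by
  classical
  induction F using Finset.induction_on with
  | empty => simp
  | insert a F ha ih =>
    rw [Finset.set_biUnion_insert, Finset.sum_insert ha]
    exact (lintegral_union_le _ _ _).trans (by gcongr)

/-- The averages over parallelepipeds are controlled by a sum over a lattice of tiles. -/
lemma avgEnergy_le_tsum_tile {Φ : E3 →ₗ[ℝ] E3} (h : LinearMap.det Φ ≠ 0) {Y : Set (Fin 3 → ℝ)}
    (hY : unitCube ⊆ Y) (m : ℕ) (S : E3 → ℝ≥0∞) :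
    avgEnergy Φ m S ≤
      ((2 * m + 3 : ℕ) : ℝ≥0∞) ^ 6 * (absDet Φ * ∑' k, (∫⁻ y in latticeTile Φ Y k, S y) ^ 2) := by
  -- A parallelepiped of size `m` centred in the cell of `k` meets only cells `k + l` with `|l|_∞ ≤
  -- m + 1`. The number `(2m+3)³` of such `l` enters twice: in Cauchy–Schwarz, and because each tile
  -- is counted once for every `l`.
  set F : Finset (Fin 3 → ℤ) := Fintype.piFinset fun _ => Finset.Icc (-(m + 1 : ℤ)) (m + 1) with hF
  have hcard : F.card = (2 * m + 3) ^ 3 := by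
    rw [hF, Fintype.card_piFinset]
    simp only [Int.card_Icc, Finset.prod_const, Finset.card_univ, Fintype.card_fin]
    congr 1
    omega
  set a : (Fin 3 → ℤ) → ℝ≥0∞ := fun k => ∫⁻ y in latticeTile Φ Y k, S y with ha
  have hcov : ∀ k, ∀ x ∈ latticeTile Φ unitCube k,
      ∫⁻ y in paral Φ m x, S y ≤ ∑ l ∈ F, a (k + l) := by
    intro k x hx
    have hsub : paral Φ m x ⊆ ⋃ l ∈ F, latticeTile Φ Y (k + l) := by
      intro y hy
      simp only [Set.mem_iUnion]
      refine ⟨fun i => ⌊Φ y i + 1 / 2⌋ - k i, ?_, ?_⟩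
      · rw [hF, Fintype.mem_piFinset]
        intro i
        have h1 := hy i
        rw [map_sub, PiLp.sub_apply, abs_le] at h1
        have h2 := hx i
        simp only [] at h2
        have h3 := Int.floor_le (Φ y i + 1 / 2)
        have h4 := Int.lt_floor_add_one (Φ y i + 1 / 2)
        rw [Finset.mem_Icc]
        constructor
        · have : (-(m + 2 : ℤ) : ℝ) < ((⌊Φ y i + 1 / 2⌋ - k i : ℤ) : ℝ) := by
            push_cast; linarith [h1.1, h1.2, h2.1, h2.2]
          have : (-(m + 2 : ℤ)) < (⌊Φ y i + 1 / 2⌋ - k i : ℤ) := by exact_mod_cast this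
          omega
        · have : ((⌊Φ y i + 1 / 2⌋ - k i : ℤ) : ℝ) < ((m + 2 : ℤ) : ℝ) := by
            push_cast; linarith [h1.1, h1.2, h2.1, h2.2]
          have : (⌊Φ y i + 1 / 2⌋ - k i : ℤ) < (m + 2 : ℤ) := by exact_mod_cast this
          omega
      · refine hY fun i => ?_
        have h3 := Int.floor_le (Φ y i + 1 / 2)
        have h4 := Int.lt_floor_add_one (Φ y i + 1 / 2)
        simp only [Pi.add_apply, add_sub_cancel]
        constructor <;> linarith
    calc ∫⁻ y in paral Φ m x, S y
        ≤ ∫⁻ y in ⋃ l ∈ F, latticeTile Φ Y (k + l), S y := lintegral_mono_set hsub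
      _ ≤ ∑ l ∈ F, a (k + l) := lintegral_biUnion_finset_le F _ S
  calc avgEnergy Φ m S
      = absDet Φ ^ 2 * ∑' k, ∫⁻ x in latticeTile Φ unitCube k,
          (∫⁻ y in paral Φ m x, S y) ^ 2 := by rw [avgEnergy, lintegral_eq_tsum_cell Φ]
    _ ≤ absDet Φ ^ 2 * ∑' k, ∫⁻ x in latticeTile Φ unitCube k,
          (F.card * ∑ l ∈ F, a (k + l) ^ 2) := by
        gcongr 2 with k
        refine setLIntegral_mono' (measurableSet_cell Φ k) fun x hx => ?_
        exact (pow_le_pow_left₀ (by simp) (hcov k x hx) 2).trans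
          (ENNReal.sq_sum_le_card_mul_sum_sq _ _)
    _ = absDet Φ * (F.card * ∑' k, ∑ l ∈ F, a (k + l) ^ 2) := by
        simp only [setLIntegral_const]
        rw [sq, mul_assoc, ← ENNReal.tsum_mul_left (a := absDet Φ),
          ← ENNReal.tsum_mul_left (a := (F.card : ℝ≥0∞))]
        congr 1
        refine tsum_congr fun k => ?_
        rw [mul_left_comm, absDet_mul_volume_cell h, mul_one]
    _ = absDet Φ * (F.card * (F.card * ∑' k, a k ^ 2)) := by
        congr 2
        rw [Summable.tsum_finsetSum (fun _ _ => ENNReal.summable), ← nsmul_eq_mul]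
        refine Finset.sum_eq_card_nsmul fun l _ => ?_
        exact (Equiv.addRight l).tsum_eq (fun k => a k ^ 2)
    _ = _ := by
        rw [hcard]; push_cast; ring

lemma avgEnergy_mono (Φ : E3 →ₗ[ℝ] E3) (m : ℝ) {S T : E3 → ℝ≥0∞} (h : ∀ x, S x ≤ T x) :
    avgEnergy Φ m S ≤ avgEnergy Φ m T := by
  unfold avgEnergy
  gcongr with x y
  exact h y

/-- Averages over a parallelepiped contained in a multiple of another one. -/
lemma avgEnergy_comparison {Φ Ψ : E3 →ₗ[ℝ] E3} (hΨ : LinearMap.det Ψ ≠ 0) {m₀ : ℝ} (m : ℕ)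
    (D : ℝ≥0∞) (hm : ∀ y, (∀ i, |Φ y i| ≤ m₀) → ∀ i, |Ψ y i| ≤ m)
    (hD : absDet Φ ≤ D * absDet Ψ) (S : E3 → ℝ≥0∞) :
    avgEnergy Φ m₀ S ≤ D ^ 2 * ((2 * m + 3 : ℕ) : ℝ≥0∞) ^ 6 * avgEnergy Ψ 1 S := by
  have h1 : avgEnergy Φ m₀ S ≤ D ^ 2 * avgEnergy Ψ m S := by
    unfold avgEnergy
    rw [← mul_assoc, ← mul_pow]
    gcongr with x
    exact fun y hy => hm _ hy
  have h2 := avgEnergy_le_tsum_tile hΨ subset_rfl m S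
  -- A detour through the tiling by unit cells reduces the size `m` to `1/2 + 1/2 = 1`.
  have h3 := tsum_tile_le_avgEnergy hΨ (Y := unitCube) (ρ := 1 / 2)
    (fun y hy i => by rw [abs_le]; exact ⟨(hy i).1, (hy i).2.le⟩) S
  norm_num only at h3
  calc avgEnergy Φ m₀ S ≤ D ^ 2 * avgEnergy Ψ m S := h1
    _ ≤ D ^ 2 * (((2 * m + 3 : ℕ) : ℝ≥0∞) ^ 6 * avgEnergy Ψ 1 S) := by
      gcongr
      exact h2.trans (by gcongr)
    _ = _ := by ring

/-- This is `a² + b² ≤ (a + b)²` under the integral. Superadditivity of the lower integral goes in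
the needed direction, so no measurability is required. -/
lemma avgEnergy_add_le (Φ : E3 →ₗ[ℝ] E3) (m : ℝ) (S T : E3 → ℝ≥0∞) :
    avgEnergy Φ m S + avgEnergy Φ m T ≤ avgEnergy Φ m (fun x => S x + T x) := by
  unfold avgEnergy
  rw [← mul_add]
  gcongr
  refine (le_lintegral_add _ _).trans (lintegral_mono fun x => ?_)
  refine le_trans ?_ (pow_le_pow_left₀ (by simp) (le_lintegral_add _ _) 2)
  rw [add_sq, add_right_comm]
  exact le_self_add

/-- The averaged energy is superadditive. -/
lemma sum_avgEnergy_le {ι : Type*} (s : Finset ι) (Φ : E3 →ₗ[ℝ] E3) (m : ℝ)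
    (S : ι → E3 → ℝ≥0∞) :
    ∑ i ∈ s, avgEnergy Φ m (S i) ≤ avgEnergy Φ m (fun x => ∑ i ∈ s, S i x) := by
  classical
  induction s using Finset.induction_on with
  | empty => simp
  | insert a s ha ih =>
    simp only [Finset.sum_insert ha]
    exact (by gcongr : _ ≤ _).trans (avgEnergy_add_le Φ m (S a) fun x => ∑ i ∈ s, S i x)

lemma measurable_setLIntegral_paral (Φ : E3 →ₗ[ℝ] E3) (m : ℝ) {S : E3 → ℝ≥0∞}
    (hS : Measurable S) : Measurable fun x => ∫⁻ y in paral Φ m x, S y := by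
  have hm : MeasurableSet {p : E3 × E3 | p.2 ∈ paral Φ m p.1} := by
    have : {p : E3 × E3 | p.2 ∈ paral Φ m p.1} =
        ⋂ i, {p : E3 × E3 | |Φ (p.2 - p.1) i| ≤ m} := by
      ext p; simp [paral]
    rw [this]
    refine MeasurableSet.iInter fun i => measurableSet_le ?_ measurable_const
    exact ((measurable_coord Φ i).comp (measurable_snd.sub measurable_fst)).norm
  have h2 : ∀ x, MeasurableSet (paral Φ m x) := fun x => measurable_prodMk_left hm
  have h3 : (fun x => ∫⁻ y in paral Φ m x, S y) = fun x =>
      ∫⁻ y, ({p : E3 × E3 | p.2 ∈ paral Φ m p.1}.indicator (fun p => S p.2)) (x, y) := by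
    funext x
    rw [← lintegral_indicator (h2 x)]
    rfl
  rw [h3]
  exact ((hS.comp measurable_snd).indicator hm).lintegral_prod_right'

/-- Cauchy–Schwarz, the converse of superadditivity. It is used only for boundedly many summands. -/
lemma avgEnergy_sum_le {ι : Type*} (s : Finset ι) (Φ : E3 →ₗ[ℝ] E3) (m : ℝ)
    {S : ι → E3 → ℝ≥0∞} (hS : ∀ i, Measurable (S i)) :
    avgEnergy Φ m (fun x => ∑ i ∈ s, S i x) ≤ s.card * ∑ i ∈ s, avgEnergy Φ m (S i) := by
  unfold avgEnergy
  rw [← Finset.mul_sum, mul_left_comm]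
  gcongr
  rw [← lintegral_finsetSum _ fun i _ => (measurable_setLIntegral_paral Φ m (hS i)).pow_const 2,
    ← lintegral_const_mul _ (Finset.measurable_sum _ fun i _ =>
      (measurable_setLIntegral_paral Φ m (hS i)).pow_const 2)]
  refine lintegral_mono fun x => ?_
  rw [lintegral_finsetSum _ fun i _ => hS i]
  exact ENNReal.sq_sum_le_card_mul_sum_sq _ _

lemma avgEnergy_const_mul (Φ : E3 →ₗ[ℝ] E3) (m : ℝ) {S : E3 → ℝ≥0∞} (hS : Measurable S)
    (c : ℝ≥0∞) : avgEnergy Φ m (fun x => c * S x) = c ^ 2 * avgEnergy Φ m S := by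
  unfold avgEnergy
  simp_rw [lintegral_const_mul _ hS, mul_pow]
  rw [lintegral_const_mul _ ((measurable_setLIntegral_paral Φ m hS).pow_const 2), mul_left_comm]

lemma avgEnergy_one_lt_top {Φ : E3 →ₗ[ℝ] E3} (h : LinearMap.det Φ ≠ 0) {S : E3 → ℝ≥0∞}
    (hS : ∫⁻ x, S x ≠ ⊤) : avgEnergy Φ 1 S < ⊤ := by
  have h1 := avgEnergy_le_tsum_tile h (subset_refl unitCube) 1 S
  rw [Nat.cast_one] at h1
  refine h1.trans_lt (ENNReal.mul_lt_top (by finiteness)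
    (ENNReal.mul_lt_top (absDet_ne_top Φ).lt_top ?_))
  calc ∑' k, (∫⁻ y in latticeTile Φ unitCube k, S y) ^ 2
      ≤ ∑' k, (∫⁻ y in latticeTile Φ unitCube k, S y) * ∫⁻ y, S y := by
        gcongr with k
        rw [sq]
        gcongr
        exact Measure.restrict_le_self
    _ = (∫⁻ y, S y) * ∫⁻ y, S y := by rw [ENNReal.tsum_mul_right, ← lintegral_eq_tsum_cell]
    _ < ⊤ := ENNReal.mul_lt_top hS.lt_top hS.lt_top

/-- Change of variables in averaged energies. -/
lemma avgEnergy_comp (Ψ : E3 →ₗ[ℝ] E3) (B : E3 ≃L[ℝ] E3) (m : ℝ) (S : E3 → ℝ≥0∞) :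
    absDet B.toLinearEquiv * avgEnergy (Ψ ∘ₗ B.toLinearEquiv) m (fun x => S (B x)) =
      avgEnergy Ψ m S := by
  set b := absDet B.toLinearEquiv with hb
  have hdet : LinearMap.det (B.toLinearEquiv : E3 →ₗ[ℝ] E3) ≠ 0 :=
    (LinearEquiv.isUnit_det' B.toLinearEquiv).ne_zero
  have hmap : Measure.map B volume = b⁻¹ • (volume : Measure E3) := by
    have := Measure.map_linearMap_addHaar_eq_smul_addHaar (volume : Measure E3) hdet
    rw [abs_inv, ENNReal.ofReal_inv_of_pos (abs_pos.2 hdet)] at this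
    exact this
  have hemb : MeasurableEmbedding B := B.toHomeomorph.measurableEmbedding
  have h0 : b ≠ 0 := absDet_ne_zero hdet
  have ht : b ≠ ⊤ := absDet_ne_top _
  have hcv : ∀ F : E3 → ℝ≥0∞, ∫⁻ x, F (B x) = b⁻¹ * ∫⁻ x, F x := by
    intro F
    rw [← hemb.lintegral_map, hmap, lintegral_smul_measure, smul_eq_mul]
  have hin : ∀ x, ∫⁻ y in paral (Ψ ∘ₗ B.toLinearEquiv) m x, S (B y) =
      b⁻¹ * ∫⁻ y in paral Ψ m (B x), S y := by
    intro x
    have : paral (Ψ ∘ₗ B.toLinearEquiv) m x = B ⁻¹' paral Ψ m (B x) := by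
      ext y; simp [paral]
    rw [this, ← hemb.lintegral_map, ← hemb.restrict_map, hmap, Measure.restrict_smul,
      lintegral_smul_measure, smul_eq_mul]
  have hd : absDet (Ψ ∘ₗ B.toLinearEquiv) = absDet Ψ * b := by
    rw [absDet, LinearMap.det_comp, abs_mul, ENNReal.ofReal_mul (abs_nonneg _)]
    rfl
  -- The factor in front and the squared determinant give `b³`. The two inner integrals and the
  -- outer one give `b⁻¹` each.
  unfold avgEnergy
  simp_rw [hin, mul_pow]
  rw [hcv (fun z => b⁻¹ ^ 2 * (∫⁻ y in paral Ψ m z, S y) ^ 2),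
    lintegral_const_mul' _ _ (by finiteness), hd]
  have e : b * b⁻¹ = 1 := ENNReal.mul_inv_cancel h0 ht
  calc _ = (b * b⁻¹) ^ 3 * (absDet Ψ ^ 2 * ∫⁻ z, (∫⁻ y in paral Ψ m z, S y) ^ 2) := by ring
    _ = _ := by rw [e]; ring

/-! ### Boxes adapted to the cone -/

/-- The coordinates of the box spanned by the curve `(η² / 2, η, 1)` and its derivatives, with
dimensions `ρ s²`, `ρ s`, `ρ`. -/
noncomputable def boxMap (η s ρ : ℝ) : E3 →ₗ[ℝ] E3 :=
  Matrix.toLpLin 2 2 !![η ^ 2 / 2 / (ρ * s ^ 2), η / (ρ * s ^ 2), 1 / (ρ * s ^ 2);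
    η / (ρ * s), 1 / (ρ * s), 0; 1 / ρ, 0, 0]

/-- The coordinates in which `tileU η s ρ` is the tiling by unit cubes. -/
noncomputable def tileMap (η s ρ : ℝ) : E3 →ₗ[ℝ] E3 :=
  Matrix.toLpLin 2 2
    !![coreDir η 0 / (2 * ρ * s ^ 2), coreDir η 1 / (2 * ρ * s ^ 2), coreDir η 2 / (2 * ρ * s ^ 2);
      normalDir η 0 / (2 * ρ), normalDir η 1 / (2 * ρ), normalDir η 2 / (2 * ρ);
      tangentDir η 0 / (2 * ρ * s), tangentDir η 1 / (2 * ρ * s), tangentDir η 2 / (2 * ρ * s)]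

lemma boxMap_zero (η s ρ : ℝ) (y : E3) :
    boxMap η s ρ y 0 = (η ^ 2 / 2 * y 0 + η * y 1 + y 2) / (ρ * s ^ 2) := by
  simp [boxMap, Matrix.mulVec, dotProduct, Fin.sum_univ_three]
  ring

lemma boxMap_one (η s ρ : ℝ) (y : E3) : boxMap η s ρ y 1 = (η * y 0 + y 1) / (ρ * s) := by
  simp [boxMap, Matrix.mulVec, dotProduct, Fin.sum_univ_three]
  ring

lemma boxMap_two (η s ρ : ℝ) (y : E3) : boxMap η s ρ y 2 = y 0 / ρ := by
  simp [boxMap, Matrix.mulVec, dotProduct, Fin.sum_univ_three]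
  ring

lemma tileMap_zero (η s ρ : ℝ) (y : E3) :
    tileMap η s ρ y 0 = ⟪coreDir η, y⟫ / (2 * ρ * s ^ 2) := by
  simp [tileMap, Matrix.mulVec, dotProduct, Fin.sum_univ_three, PiLp.inner_apply]
  ring

lemma tileMap_one (η s ρ : ℝ) (y : E3) : tileMap η s ρ y 1 = ⟪normalDir η, y⟫ / (2 * ρ) := by
  simp [tileMap, Matrix.mulVec, dotProduct, Fin.sum_univ_three, PiLp.inner_apply]
  ring

lemma tileMap_two (η s ρ : ℝ) (y : E3) :
    tileMap η s ρ y 2 = ⟪tangentDir η, y⟫ / (2 * ρ * s) := by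
  simp [tileMap, Matrix.mulVec, dotProduct, Fin.sum_univ_three, PiLp.inner_apply]
  ring

lemma inner_coreDir (η : ℝ) (y : E3) : ⟪coreDir η, y⟫ =
    √2 / (1 + η ^ 2 / 2) * (η ^ 2 / 2 * y 0 + η * y 1 + y 2) := by
  simp [coreDir, Fin.sum_univ_three, PiLp.inner_apply]
  ring

lemma inner_normalDir (η : ℝ) (y : E3) : ⟪normalDir η, y⟫ =
    √2 / (1 + η ^ 2 / 2) * (-y 0 + η * y 1 - η ^ 2 / 2 * y 2) := by
  simp [normalDir, Fin.sum_univ_three, PiLp.inner_apply]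
  ring

lemma inner_tangentDir (η : ℝ) (y : E3) : ⟪tangentDir η, y⟫ =
    1 / (1 + η ^ 2 / 2) * (-η * y 0 + (η ^ 2 / 2 - 1) * y 1 + η * y 2) := by
  simp [tangentDir, Fin.sum_univ_three, PiLp.inner_apply]
  ring

lemma det_boxMap (η s ρ : ℝ) : LinearMap.det (boxMap η s ρ) = -(1 / (ρ ^ 3 * s ^ 3)) := by
  rw [boxMap, LinearMap.det_toLpLin, Matrix.det_fin_three]
  simp
  ring

lemma det_tileMap (η s ρ : ℝ) : |LinearMap.det (tileMap η s ρ)| = |1 / (4 * (ρ ^ 3 * s ^ 3))| := by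
  have key : LinearMap.det (tileMap η s ρ) = (√2 / (1 + η ^ 2 / 2)) ^ 2 *
      (1 / (1 + η ^ 2 / 2)) * (1 + η ^ 2 / 2) ^ 3 * (1 / (8 * (ρ ^ 3 * s ^ 3))) := by
    rw [tileMap, LinearMap.det_toLpLin, Matrix.det_fin_three]
    simp only [coreDir, normalDir, tangentDir, PiLp.smul_apply, smul_eq_mul]
    generalize √2 / (1 + η ^ 2 / 2) = a
    generalize 1 / (1 + η ^ 2 / 2) = b
    simp
    ring
  have h3 : (√2 / (1 + η ^ 2 / 2)) ^ 2 * (1 / (1 + η ^ 2 / 2)) * (1 + η ^ 2 / 2) ^ 3 = 2 := by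
    have hq : (1 + η ^ 2 / 2) ≠ 0 := by positivity
    generalize 1 + η ^ 2 / 2 = q at hq
    rw [div_pow, Real.sq_sqrt (by norm_num)]
    field_simp
  rw [key, h3]
  congr 1
  ring

lemma det_boxMap_ne_zero {η s ρ : ℝ} (hs : 0 < s) (hρ : 0 < ρ) :
    LinearMap.det (boxMap η s ρ) ≠ 0 := by
  rw [det_boxMap, neg_ne_zero]; positivity

lemma det_tileMap_ne_zero {η s ρ : ℝ} (hs : 0 < s) (hρ : 0 < ρ) :
    LinearMap.det (tileMap η s ρ) ≠ 0 := by
  rw [← abs_ne_zero, det_tileMap, abs_ne_zero]; positivity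

lemma absDet_boxMap {η s ρ : ℝ} (hs : 0 < s) (hρ : 0 < ρ) :
    absDet (boxMap η s ρ) = ENNReal.ofReal (1 / (ρ ^ 3 * s ^ 3)) := by
  rw [absDet, det_boxMap, abs_neg, abs_of_pos (by positivity)]

lemma absDet_tileMap {η s ρ : ℝ} (hs : 0 < s) (hρ : 0 < ρ) :
    absDet (tileMap η s ρ) = ENNReal.ofReal (1 / (4 * (ρ ^ 3 * s ^ 3))) := by
  rw [absDet, det_tileMap, abs_of_pos (by positivity)]

lemma boxMap_abs_le_iff {η s ρ m : ℝ} (hs : 0 < s) (hρ : 0 < ρ) (y : E3) :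
    (∀ i, |boxMap η s ρ y i| ≤ m) ↔ |η ^ 2 / 2 * y 0 + η * y 1 + y 2| ≤ m * (ρ * s ^ 2) ∧
      |η * y 0 + y 1| ≤ m * (ρ * s) ∧ |y 0| ≤ m * ρ := by
  rw [Fin.forall_fin_succ, Fin.forall_fin_succ, Fin.forall_fin_succ]
  simp only [IsEmpty.forall_iff, and_true]
  change |boxMap η s ρ y 0| ≤ m ∧ |boxMap η s ρ y 1| ≤ m ∧ |boxMap η s ρ y 2| ≤ m ↔ _
  rw [boxMap_zero, boxMap_one, boxMap_two, abs_div, abs_div, abs_div, abs_of_pos hρ,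
    abs_of_pos (mul_pos hρ hs), abs_of_pos (mul_pos hρ (pow_pos hs 2)), div_le_iff₀ (by positivity),
    div_le_iff₀ (by positivity), div_le_iff₀ (by positivity)]

lemma tileMap_abs_le_iff {η s ρ m : ℝ} (hs : 0 < s) (hρ : 0 < ρ) (y : E3) :
    (∀ i, |tileMap η s ρ y i| ≤ m) ↔ |⟪coreDir η, y⟫| ≤ m * (2 * ρ * s ^ 2) ∧
      |⟪normalDir η, y⟫| ≤ m * (2 * ρ) ∧ |⟪tangentDir η, y⟫| ≤ m * (2 * ρ * s) := by
  rw [Fin.forall_fin_succ, Fin.forall_fin_succ, Fin.forall_fin_succ]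
  simp only [IsEmpty.forall_iff, and_true]
  change |tileMap η s ρ y 0| ≤ m ∧ |tileMap η s ρ y 1| ≤ m ∧ |tileMap η s ρ y 2| ≤ m ↔ _
  have h1 : 0 < 2 * ρ * s ^ 2 := by positivity
  have h2 : 0 < 2 * ρ := by positivity
  have h3 : 0 < 2 * ρ * s := by positivity
  rw [tileMap_zero, tileMap_one, tileMap_two, abs_div, abs_div, abs_div, abs_of_pos h1,
    abs_of_pos h2, abs_of_pos h3, div_le_iff₀ h1, div_le_iff₀ h2, div_le_iff₀ h3]

/-- The constant in the comparison of two boxes whose parameters differ by a factor `C`. -/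
def cmpConst (C : ℕ) : ℕ := (C ^ 6) ^ 2 * (2 * (3 * C ^ 3) + 3) ^ 6

/-- Boxes with comparable parameters have comparable averaged energies. -/
lemma avgEnergy_boxMap_le {η η' s s' ρ ρ' : ℝ} (C : ℕ) (hC : 1 ≤ C) (hs : 0 < s) (hs' : 0 < s')
    (hρ : 0 < ρ) (hρ' : 0 < ρ') (h1 : s ≤ C * s') (h2 : s' ≤ C * s) (h3 : ρ ≤ C * ρ')
    (h4 : ρ' ≤ C * ρ) (h5 : |η' - η| ≤ C * s') (S : E3 → ℝ≥0∞) :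
    avgEnergy (boxMap η s ρ) 1 S ≤ cmpConst C * avgEnergy (boxMap η' s' ρ') 1 S := by
  have hC' : (1 : ℝ) ≤ C := by exact_mod_cast hC
  have key := avgEnergy_comparison (Φ := boxMap η s ρ) (Ψ := boxMap η' s' ρ')
    (det_boxMap_ne_zero hs' hρ') (m₀ := 1) (3 * C ^ 3) ((C ^ 6 : ℕ) : ℝ≥0∞) ?_ ?_ S
  · refine key.trans (le_of_eq ?_)
    rw [cmpConst]; push_cast; ring
  · intro y hy
    rw [boxMap_abs_le_iff hs hρ] at hy
    rw [boxMap_abs_le_iff hs' hρ']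
    obtain ⟨a, b, c⟩ := hy
    simp only [one_mul] at a b c
    set d := η' - η with hd
    -- Taylor expansion of `γ` at `η`, exact because `γ` is quadratic. An angular shift of size `s'`
    -- changes each pairing by no more than the corresponding side of the box.
    have e0 : η' ^ 2 / 2 * y 0 + η' * y 1 + y 2 =
      (η ^ 2 / 2 * y 0 + η * y 1 + y 2) + d * (η * y 0 + y 1) + d ^ 2 / 2 * y 0 := by
      rw [hd]; ring
    have e1 : η' * y 0 + y 1 = (η * y 0 + y 1) + d * y 0 := by rw [hd]; ring
    have hd2 : |d ^ 2 / 2| ≤ (C * s') ^ 2 / 2 := by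
      rw [abs_of_nonneg (by positivity), ← sq_abs]
      have := abs_nonneg d
      gcongr
    have c' : |y 0| ≤ C * ρ' := c.trans h3
    have b' : |η * y 0 + y 1| ≤ C * ρ' * (C * s') := b.trans (by gcongr)
    have a' : |η ^ 2 / 2 * y 0 + η * y 1 + y 2| ≤ C * ρ' * (C * s') ^ 2 := a.trans (by gcongr)
    have hC3 : (C : ℝ) ≤ C ^ 3 := le_self_pow₀ hC' (by norm_num)
    have hC2 : (C : ℝ) ^ 2 ≤ C ^ 3 := pow_le_pow_right₀ hC' (by norm_num)
    push_cast
    refine ⟨?_, ?_, ?_⟩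
    · rw [e0]
      calc _ ≤ C * ρ' * (C * s') ^ 2 + (C * s') * (C * ρ' * (C * s'))
            + (C * s') ^ 2 / 2 * (C * ρ') := by
            refine (abs_add_three _ _ _).trans ?_
            rw [abs_mul, abs_mul]
            gcongr
        _ = 5 / 2 * (C ^ 3 * (ρ' * s' ^ 2)) := by ring
        _ ≤ 3 * C ^ 3 * (ρ' * s' ^ 2) := by
            have : 0 ≤ (C : ℝ) ^ 3 * (ρ' * s' ^ 2) := by positivity
            linarith
    · rw [e1]
      calc _ ≤ C * ρ' * (C * s') + (C * s') * (C * ρ') := by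
            refine (abs_add_le _ _).trans ?_
            rw [abs_mul]
            gcongr
        _ = 2 * (C ^ 2 * (ρ' * s')) := by ring
        _ ≤ 2 * (C ^ 3 * (ρ' * s')) := by gcongr
        _ ≤ 3 * C ^ 3 * (ρ' * s') := by
            have : 0 ≤ (C : ℝ) ^ 3 * (ρ' * s') := by positivity
            linarith
    · calc _ ≤ C * ρ' := c'
        _ ≤ C ^ 3 * ρ' := by gcongr
        _ ≤ 3 * C ^ 3 * ρ' := by
            have : 0 ≤ (C : ℝ) ^ 3 * ρ' := by positivity
            linarith
  · rw [absDet_boxMap hs hρ, absDet_boxMap hs' hρ', ← ENNReal.ofReal_natCast,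
      ← ENNReal.ofReal_mul (by positivity)]
    refine ENNReal.ofReal_le_ofReal ?_
    rw [mul_one_div, div_le_div_iff₀ (by positivity) (by positivity)]
    calc 1 * (ρ' ^ 3 * s' ^ 3) ≤ 1 * ((C * ρ) ^ 3 * (C * s) ^ 3) := by gcongr
      _ = ((C ^ 6 : ℕ) : ℝ) * (ρ ^ 3 * s ^ 3) := by push_cast; ring

/-- Up to factors comparable to one, the tile bounds control the pairings `E`, `N`, `T` with the
orthogonal frame. Solving for `γ' · y` involves only `E` and `T`, while `y 0` involves all three.
Since `ρ s² ≤ ρ s ≤ ρ`, each pairing is used only where its bound is at least as strong as needed.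
-/
lemma boxMap_abs_le_of_tileMap {η s ρ m : ℝ} (hs : 0 < s) (hs1 : s ≤ 1) (hρ : 0 < ρ) (hm : 0 ≤ m)
    (hη : |η| ≤ 1) (y : E3) (h : ∀ i, |tileMap η s ρ y i| ≤ m) (i : Fin 3) :
    |boxMap η s ρ y i| ≤ 16 * m := by
  revert i
  rw [tileMap_abs_le_iff hs hρ] at h
  rw [boxMap_abs_le_iff hs hρ]
  set q := 1 + η ^ 2 / 2 with hq
  have hη2 : η ^ 2 ≤ 1 := by
    rw [← sq_abs]; exact pow_le_one₀ (abs_nonneg _) hη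
  have hq1 : 1 ≤ q := by
    have := sq_nonneg η
    rw [hq]; linarith
  have hq2 : q ≤ 3 / 2 := by rw [hq]; linarith
  have hr : (1 : ℝ) ≤ √2 := Real.one_le_sqrt.2 (by norm_num)
  obtain ⟨a, b, c⟩ := h
  rw [inner_coreDir, abs_mul, abs_of_pos (by positivity)] at a
  rw [inner_normalDir, abs_mul, abs_of_pos (by positivity)] at b
  rw [inner_tangentDir, abs_mul, abs_of_pos (by positivity)] at c
  have gen : ∀ {u v w : ℝ}, 2 / 3 ≤ u → 0 ≤ v → u * v ≤ w → v ≤ 3 / 2 * w := by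
    intro u v w h1 h2 h3
    have := mul_le_mul_of_nonneg_right h1 h2
    linarith
  have hu1 : 2 / 3 ≤ 1 / q := by
    rw [le_div_iff₀ (by positivity)]; linarith
  have hu2 : 2 / 3 ≤ √2 / q := hu1.trans (by gcongr)
  have a' := gen hu2 (abs_nonneg _) a
  have b' := gen hu2 (abs_nonneg _) b
  have c' := gen hu1 (abs_nonneg _) c
  set E := η ^ 2 / 2 * y 0 + η * y 1 + y 2 with hE
  set N := -y 0 + η * y 1 - η ^ 2 / 2 * y 2 with hN
  set T := -η * y 0 + (η ^ 2 / 2 - 1) * y 1 + η * y 2 with hT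
  have hss : s ^ 2 ≤ s := by nlinarith
  have hms : m * (ρ * s ^ 2) ≤ m * (ρ * s) := by gcongr
  have hm1 : m * (ρ * s) ≤ m * ρ := by
    gcongr; nlinarith
  have e1 : q * (η * y 0 + y 1) = η * E - T := by rw [hq, hE, hT]; ring
  have e2 : q ^ 2 * y 0 = -(η ^ 2 / 2) * E + η * (q * (η * y 0 + y 1)) - N := by
    rw [hq, hE, hN]; ring
  have f1 : |q * (η * y 0 + y 1)| ≤ |E| + |T| := by
    rw [e1]
    refine (abs_sub _ _).trans ?_
    rw [abs_mul]
    gcongr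
    exact mul_le_of_le_one_left (abs_nonneg E) hη
  have f2 : |q ^ 2 * y 0| ≤ |E| + (|E| + |T|) + |N| := by
    rw [e2]
    refine (abs_sub _ _).trans ?_
    gcongr
    refine (abs_add_le _ _).trans ?_
    rw [abs_mul, abs_mul η]
    gcongr ?_ + ?_
    · rw [abs_neg, abs_of_nonneg (by positivity)]
      exact mul_le_of_le_one_left (abs_nonneg E) (by linarith)
    · exact (mul_le_of_le_one_left (abs_nonneg _) hη).trans f1
  refine ⟨?_, ?_, ?_⟩
  · have : 0 ≤ m * (ρ * s ^ 2) := by positivity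
    linarith
  · have h6 : |η * y 0 + y 1| ≤ |q * (η * y 0 + y 1)| := by
      rw [abs_mul, abs_of_pos (by positivity : 0 < q)]
      exact le_mul_of_one_le_left (abs_nonneg _) hq1
    have : 0 ≤ m * (ρ * s) := by positivity
    linarith
  · have h6 : |y 0| ≤ |q ^ 2 * y 0| := by
      rw [abs_mul, abs_of_pos (by positivity : 0 < q ^ 2)]
      exact le_mul_of_one_le_left (abs_nonneg _) (one_le_pow₀ hq1)
    have : 0 ≤ m * (ρ * s) := by positivity
    linarith

/-- The inverse change of frame has the same triangular structure: the tangential pairing does not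
see `y 0`, which has the weakest bound. -/
lemma tileMap_abs_le_of_boxMap {η s ρ m : ℝ} (hs : 0 < s) (hs1 : s ≤ 1) (hρ : 0 < ρ) (hm : 0 ≤ m)
    (hη : |η| ≤ 1) (y : E3) (h : ∀ i, |boxMap η s ρ y i| ≤ m) (i : Fin 3) :
    |tileMap η s ρ y i| ≤ 16 * m := by
  revert i
  rw [boxMap_abs_le_iff hs hρ] at h
  rw [tileMap_abs_le_iff hs hρ]
  set q := 1 + η ^ 2 / 2 with hq
  have hη2 : η ^ 2 ≤ 1 := by
    rw [← sq_abs]; exact pow_le_one₀ (abs_nonneg _) hη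
  have hq1 : 1 ≤ q := by
    have := sq_nonneg η
    rw [hq]; linarith
  have hq2 : q ≤ 3 / 2 := by rw [hq]; linarith
  have hr : √2 ≤ (2 : ℝ) := Real.sqrt_le_iff.2 (by norm_num)
  have hu1 : 1 / q ≤ 2 := by rw [div_le_iff₀ (by positivity)]; linarith
  have hu2 : √2 / q ≤ 2 := by rw [div_le_iff₀ (by positivity)]; nlinarith
  obtain ⟨a, b, c⟩ := h
  rw [inner_coreDir, abs_mul, abs_of_pos (by positivity : 0 < √2 / (1 + η ^ 2 / 2)),
    inner_normalDir, abs_mul, abs_of_pos (by positivity : 0 < √2 / (1 + η ^ 2 / 2)),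
    inner_tangentDir, abs_mul, abs_of_pos (by positivity : 0 < 1 / (1 + η ^ 2 / 2))]
  set E := η ^ 2 / 2 * y 0 + η * y 1 + y 2 with hE
  set E' := η * y 0 + y 1 with hE'
  have hss : s ^ 2 ≤ s := by nlinarith
  have hms : m * (ρ * s ^ 2) ≤ m * (ρ * s) := by gcongr
  have hm1 : m * (ρ * s) ≤ m * ρ := by
    gcongr; nlinarith
  have e1 : -η * y 0 + (η ^ 2 / 2 - 1) * y 1 + η * y 2 = η * E - q * E' := by
    rw [hq, hE, hE']; ring
  have e2 : -y 0 + η * y 1 - η ^ 2 / 2 * y 2 = -(η ^ 2 / 2) * E + η * q * E' - q ^ 2 * y 0 := by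
    rw [hq, hE, hE']; ring
  have hE0 := abs_nonneg E
  have hE0' := abs_nonneg E'
  have hy0 := abs_nonneg (y 0)
  have f1 : |η * E - q * E'| ≤ |E| + 3 / 2 * |E'| := by
    refine (abs_sub _ _).trans ?_
    rw [abs_mul, abs_mul, abs_of_pos (by positivity : 0 < q)]
    gcongr
    exact mul_le_of_le_one_left (abs_nonneg E) hη
  have f2 : |-(η ^ 2 / 2) * E + η * q * E' - q ^ 2 * y 0| ≤ |E| + 3 / 2 * |E'| + 9 / 4 * |y 0| := by
    refine (abs_sub _ _).trans ?_
    gcongr ?_ + ?_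
    · refine (abs_add_le _ _).trans ?_
      rw [abs_mul, abs_mul, abs_mul, abs_of_pos (by positivity : 0 < q), abs_neg,
        abs_of_nonneg (by positivity : 0 ≤ η ^ 2 / 2)]
      gcongr ?_ + ?_ * _
      · exact mul_le_of_le_one_left (abs_nonneg E) (by linarith)
      · exact (mul_le_of_le_one_left (by positivity) hη).trans hq2
    · rw [abs_mul, abs_of_pos (by positivity)]
      gcongr
      calc q ^ 2 ≤ (3 / 2) ^ 2 := by gcongr
        _ ≤ _ := by norm_num
  rw [e1, e2]
  refine ⟨?_, ?_, ?_⟩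
  · have : 0 ≤ m * (ρ * s ^ 2) := by positivity
    calc _ ≤ 2 * (m * (ρ * s ^ 2)) := by gcongr
      _ ≤ _ := by linarith
  · have : 0 ≤ m * (ρ * s) := by positivity
    calc _ ≤ 2 * (|E| + 3 / 2 * |E'| + 9 / 4 * |y 0|) := by gcongr
      _ ≤ _ := by linarith
  · have : 0 ≤ m * (ρ * s) := by positivity
    calc _ ≤ 2 * (|E| + 3 / 2 * |E'|) := by gcongr
      _ ≤ _ := by linarith

/-! ### Sums over tilings and averaged energies -/

/-- The square of the square function of a finite family. -/
noncomputable def sqDensity {ι : Type*} (F : Finset ι) (h : ι → 𝓢(E3, ℂ)) (x : E3) : ℝ≥0∞ :=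
  ∑ i ∈ F, ‖h i x‖ₑ ^ 2

lemma measurable_enorm_sq (h : 𝓢(E3, ℂ)) : Measurable fun x => ‖h x‖ₑ ^ 2 :=
  (h.continuous.measurable.enorm).pow_const 2

lemma measurable_sqDensity {ι : Type*} (F : Finset ι) (h : ι → 𝓢(E3, ℂ)) :
    Measurable (sqDensity F h) :=
  Finset.measurable_sum _ fun i _ => measurable_enorm_sq (h i)

lemma sqDensity_mono {ι : Type*} {F G : Finset ι} (hFG : F ⊆ G) (h : ι → 𝓢(E3, ℂ)) (x : E3) :
    sqDensity F h x ≤ sqDensity G h x :=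
  Finset.sum_le_sum_of_subset hFG

/-- The square function enters only through its square. Both sides of the multiscale inequality thus
become quadratic in densities that are additive over the pieces. -/
lemma normalizedL2_sqrt {ι : Type*} (F : Finset ι) (h : ι → 𝓢(E3, ℂ)) (U : Set E3) :
    normalizedL2 U (fun x => √(∑ i ∈ F, ‖h i x‖ ^ 2)) =
      (volume U)⁻¹ * (∫⁻ x in U, sqDensity F h x) ^ 2 := by
  rw [normalizedL2, eLpNorm_eq_lintegral_rpow_enorm_toReal (by norm_num) (by norm_num)]
  have h1 : ∀ x, ‖√(∑ i ∈ F, ‖h i x‖ ^ 2)‖ₑ ^ (2 : ℝ≥0∞).toReal = sqDensity F h x := by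
    intro x
    have h0 : 0 ≤ ∑ i ∈ F, ‖h i x‖ ^ 2 := by positivity
    rw [ENNReal.toReal_ofNat, ENNReal.rpow_ofNat, Real.enorm_of_nonneg (Real.sqrt_nonneg _),
      ← ENNReal.ofReal_pow (Real.sqrt_nonneg _), Real.sq_sqrt h0,
      ENNReal.ofReal_sum_of_nonneg (fun i _ => by positivity), sqDensity]
    refine Finset.sum_congr rfl fun i _ => ?_
    rw [ENNReal.ofReal_pow (norm_nonneg _), ofReal_norm]
  simp_rw [h1]
  congr 1
  rw [← ENNReal.rpow_natCast, ← ENNReal.rpow_mul, ← ENNReal.rpow_natCast]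
  norm_num

lemma lintegral_sqDensity_ne_top {ι : Type*} (F : Finset ι) (h : ι → 𝓢(E3, ℂ)) :
    ∫⁻ x, sqDensity F h x ≠ ⊤ := by
  unfold sqDensity
  rw [lintegral_finsetSum _ fun i _ => measurable_enorm_sq (h i)]
  refine (ENNReal.sum_lt_top.2 fun i _ => ?_).ne
  have := lintegral_rpow_enorm_lt_top_of_eLpNorm_lt_top (p := 2) (by norm_num) (by norm_num)
    ((h i).memLp 2 volume).2
  simpa using this

lemma one_le_absDet_mul_volume_tile {Φ : E3 →ₗ[ℝ] E3} (h : LinearMap.det Φ ≠ 0)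
    {Y : Set (Fin 3 → ℝ)} (hY : unitCube ⊆ Y) (k : Fin 3 → ℤ) :
    1 ≤ absDet Φ * volume (latticeTile Φ Y k) := by
  rw [← absDet_mul_volume_cell h k]
  gcongr
  exact fun x hx => hY hx

lemma absDet_mul_volume_tile_le {Φ : E3 →ₗ[ℝ] E3} (h : LinearMap.det Φ ≠ 0)
    {Y : Set (Fin 3 → ℝ)} (hY : ∀ y ∈ Y, ∀ i, |y i| ≤ 1) (k : Fin 3 → ℤ) :
    absDet Φ * volume (latticeTile Φ Y k) ≤ 8 := by
  have h1 : latticeTile Φ Y k ⊆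
      Φ ⁻¹' {x : E3 | ∀ i, x i ∈ Set.Icc ((k i : ℝ) - 1) (k i + 1)} := by
    intro x hx i
    have := abs_le.1 (hY _ hx i)
    constructor <;> linarith [this.1, this.2]
  calc _ ≤ absDet Φ * volume (Φ ⁻¹' {x : E3 | ∀ i, x i ∈ Set.Icc ((k i : ℝ) - 1) (k i + 1)}) := by
        gcongr
    _ ≤ 8 := by
        rw [absDet_mul_volume_preimage h, volume_setOf_forall_mem]
        simp only [Real.volume_Icc]
        norm_num

/-- A shape between the unit cube and `[-1, 1]³` has volume comparable to that of a cell. This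
covers both the tiles `U` and the overlapping balls. -/
lemma tsum_normalized_tile_le {Φ : E3 →ₗ[ℝ] E3} (h : LinearMap.det Φ ≠ 0) {Y : Set (Fin 3 → ℝ)}
    (hY : unitCube ⊆ Y) (hY' : ∀ y ∈ Y, ∀ i, |y i| ≤ 1) (S : E3 → ℝ≥0∞) :
    ∑' k, (volume (latticeTile Φ Y k))⁻¹ * (∫⁻ y in latticeTile Φ Y k, S y) ^ 2 ≤
      avgEnergy Φ (3 / 2) S := by
  have h1 := tsum_tile_le_avgEnergy h hY' S
  norm_num only at h1
  refine le_trans ?_ h1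
  rw [← ENNReal.tsum_mul_left]
  gcongr with k
  rw [ENNReal.inv_le_iff_inv_le, ENNReal.inv_le_iff_le_mul (fun _ => absDet_ne_zero h)
    (fun h0 => absurd h0 (absDet_ne_top Φ))]
  exact one_le_absDet_mul_volume_tile h hY k

lemma avgEnergy_le_tsum_normalized_tile {Φ : E3 →ₗ[ℝ] E3} (h : LinearMap.det Φ ≠ 0)
    {Y : Set (Fin 3 → ℝ)} (hY : unitCube ⊆ Y) (hY' : ∀ y ∈ Y, ∀ i, |y i| ≤ 1) (S : E3 → ℝ≥0∞) :
    avgEnergy Φ 1 S ≤ ((8 * 5 ^ 6 : ℕ) : ℝ≥0∞) *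
      ∑' k, (volume (latticeTile Φ Y k))⁻¹ * (∫⁻ y in latticeTile Φ Y k, S y) ^ 2 := by
  have h1 := avgEnergy_le_tsum_tile h hY 1 S
  rw [Nat.cast_one] at h1
  refine h1.trans ?_
  have h2 : absDet Φ * ∑' k, (∫⁻ y in latticeTile Φ Y k, S y) ^ 2 ≤
      8 * ∑' k, (volume (latticeTile Φ Y k))⁻¹ * (∫⁻ y in latticeTile Φ Y k, S y) ^ 2 := by
    rw [← ENNReal.tsum_mul_left, ← ENNReal.tsum_mul_left]
    refine ENNReal.tsum_le_tsum fun k => ?_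
    rw [← mul_assoc]
    gcongr
    rw [← div_eq_mul_inv]
    have h8 := absDet_mul_volume_tile_le h hY' k
    have h0 : volume (latticeTile Φ Y k) ≠ 0 := by
      intro h0
      have := one_le_absDet_mul_volume_tile h hY k
      rw [h0] at this
      simp at this
    have ht : volume (latticeTile Φ Y k) ≠ ⊤ := by
      intro ht
      rw [ht, ENNReal.mul_top (absDet_ne_zero h)] at h8
      simp at h8
    rwa [ENNReal.le_div_iff_mul_le (Or.inl h0) (Or.inl ht)]
  calc _ ≤ ((2 * 1 + 3 : ℕ) : ℝ≥0∞) ^ 6 * (8 * ∑' k, (volume (latticeTile Φ Y k))⁻¹ *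
        (∫⁻ y in latticeTile Φ Y k, S y) ^ 2) := by gcongr
    _ = _ := by push_cast; ring

/-- The directions `𝐜, 𝐧, 𝐭` are orthogonal with squared lengths `2, 2, 1`. Translation by `ρ s² 𝐜`,
`ρ 𝐧` or `2ρ s 𝐭` therefore moves the corresponding pairing by exactly one full width of the box. -/
lemma tileU_eq_latticeTile {η s ρ : ℝ} (hs : 0 < s) (hρ : 0 < ρ) (k : Fin 3 → ℤ) :
    tileU η s ρ k = latticeTile (tileMap η s ρ) {y | ∀ i, |y i| ≤ 1 / 2} k := by
  have hq : (1 + η ^ 2 / 2) ≠ 0 := by positivity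
  have hr : √2 * √2 = (2 : ℝ) := Real.mul_self_sqrt (by norm_num)
  have cc : ⟪coreDir η, coreDir η⟫ = (2 : ℝ) := by
    rw [inner_coreDir]
    simp only [coreDir, PiLp.smul_apply, smul_eq_mul, Matrix.cons_val]
    field_simp
    linear_combination (2 + η ^ 2) ^ 2 * hr
  have nn : ⟪normalDir η, normalDir η⟫ = (2 : ℝ) := by
    rw [inner_normalDir]
    simp only [normalDir, PiLp.smul_apply, smul_eq_mul, Matrix.cons_val]
    field_simp
    linear_combination (2 + η ^ 2) ^ 2 * hr
  have tt : ⟪tangentDir η, tangentDir η⟫ = (1 : ℝ) := by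
    rw [inner_tangentDir]
    simp only [tangentDir, PiLp.smul_apply, smul_eq_mul, Matrix.cons_val]
    field_simp
    ring
  have cn : ⟪coreDir η, normalDir η⟫ = (0 : ℝ) := by
    rw [inner_coreDir]
    simp only [normalDir, PiLp.smul_apply, smul_eq_mul, Matrix.cons_val]
    ring
  have ct : ⟪coreDir η, tangentDir η⟫ = (0 : ℝ) := by
    rw [inner_coreDir]
    simp only [tangentDir, PiLp.smul_apply, smul_eq_mul, Matrix.cons_val]
    ring
  have nt : ⟪normalDir η, tangentDir η⟫ = (0 : ℝ) := by
    rw [inner_normalDir]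
    simp only [tangentDir, PiLp.smul_apply, smul_eq_mul, Matrix.cons_val]
    ring
  have nc : ⟪normalDir η, coreDir η⟫ = (0 : ℝ) := by rw [real_inner_comm, cn]
  have tc : ⟪tangentDir η, coreDir η⟫ = (0 : ℝ) := by rw [real_inner_comm, ct]
  have tn : ⟪tangentDir η, normalDir η⟫ = (0 : ℝ) := by rw [real_inner_comm, nt]
  ext x
  simp only [tileU, boxU, latticeTile, Set.mem_ofPred_eq, inner_sub_right, inner_add_right,
    real_inner_smul_right, cc, nn, tt, cn, ct, nt, nc, tc, tn]
  rw [Fin.forall_fin_succ, Fin.forall_fin_succ, Fin.forall_fin_succ]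
  simp only [IsEmpty.forall_iff, and_true]
  change _ ↔ |tileMap η s ρ x 0 - k 0| ≤ 1 / 2 ∧ |tileMap η s ρ x 1 - k 1| ≤ 1 / 2 ∧
    |tileMap η s ρ x 2 - k 2| ≤ 1 / 2
  have aux : ∀ (u v w : ℝ), 0 < v → (|u / v - w| ≤ 1 / 2 ↔ |u - w * v| ≤ v / 2) := by
    intro u v w hv
    rw [show u / v - w = (u - w * v) / v by field_simp, abs_div, abs_of_pos hv,
      div_le_iff₀ hv]
    constructor <;> intro h <;> linarith
  rw [tileMap_zero, tileMap_one, tileMap_two, aux _ _ _ (by positivity),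
    aux _ _ _ (by positivity), aux _ _ _ (by positivity)]
  refine and_congr ?_ (and_congr ?_ ?_) <;>
  · rw [← Iff.of_eq (congrArg₂ (· ≤ ·) (congrArg abs ?_) ?_)] <;> ring

/-- The coordinates in which the balls `coverBall r k` have radius one and integer centres. -/
noncomputable def ballMap (r : ℝ) : E3 →ₗ[ℝ] E3 := r⁻¹ • LinearMap.id

lemma det_ballMap (r : ℝ) : LinearMap.det (ballMap r) = 1 / r ^ 3 := by
  simp [ballMap]

lemma coverBall_eq_latticeTile {r : ℝ} (hr : 0 < r) (k : Fin 3 → ℤ) :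
    coverBall r k = latticeTile (ballMap r) {y | ∑ i, y i ^ 2 ≤ 1} k := by
  ext x
  simp only [coverBall, latticeTile, Set.mem_ofPred_eq, Metric.mem_closedBall]
  rw [EuclideanSpace.dist_eq, Real.sqrt_le_left hr.le, Fin.sum_univ_three, Fin.sum_univ_three]
  have e : ∀ i, (ballMap r x i - k i) ^ 2 = (x i - r * k i) ^ 2 / r ^ 2 := by
    intro i
    simp [ballMap]
    field_simp
  rw [e, e, e, ← add_div, ← add_div, div_le_one (by positivity)]
  simp [Real.dist_eq, sq_abs]

/-- A constant that bounds the losses in passing between tilings and averages. -/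
def gridConst : ℕ := 128 * 175 ^ 6

lemma abs_le_one_of_sum_sq_le (y : Fin 3 → ℝ) (hy : ∑ i, y i ^ 2 ≤ 1) (i : Fin 3) : |y i| ≤ 1 := by
  rw [← sq_le_one_iff_abs_le_one]
  exact (Finset.single_le_sum (f := fun i => y i ^ 2) (fun i _ => sq_nonneg _)
    (Finset.mem_univ i)).trans hy

lemma unitCube_subset_ball : unitCube ⊆ {y | ∑ i, y i ^ 2 ≤ 1} := by
  intro y hy
  have : ∀ i, y i ^ 2 ≤ 1 / 4 := fun i => by
    have := hy i
    nlinarith [this.1, this.2]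
  rw [Set.mem_ofPred_eq, Fin.sum_univ_three]
  linarith [this 0, this 1, this 2]

lemma ballMap_abs_le_iff {r m : ℝ} (hr : 0 < r) (y : E3) :
    (∀ i, |ballMap r y i| ≤ m) ↔ ∀ i, |boxMap 0 1 r y i| ≤ m := by
  rw [boxMap_abs_le_iff one_pos hr, Fin.forall_fin_succ, Fin.forall_fin_succ, Fin.forall_fin_succ]
  simp only [IsEmpty.forall_iff, and_true]
  change |ballMap r y 0| ≤ m ∧ |ballMap r y 1| ≤ m ∧ |ballMap r y 2| ≤ m ↔ _
  have e : ∀ i, |ballMap r y i| ≤ m ↔ |y i| ≤ m * r := by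
    intro i
    have : ballMap r y i = y i / r := by simp [ballMap]; ring
    rw [this, abs_div, abs_of_pos hr, div_le_iff₀ hr]
  rw [e, e, e]
  norm_num
  tauto

lemma absDet_ballMap {r : ℝ} (hr : 0 < r) : absDet (ballMap r) = absDet (boxMap 0 1 r) := by
  rw [absDet_boxMap one_pos hr, absDet, det_ballMap, abs_of_pos (by positivity)]
  norm_num

lemma det_ballMap_ne_zero {r : ℝ} (hr : 0 < r) : LinearMap.det (ballMap r) ≠ 0 := by
  rw [det_ballMap]; positivity

lemma tsum_coverBall_le {ι : Type*} (F : Finset ι) (h : ι → 𝓢(E3, ℂ)) {r : ℝ} (hr : 0 < r) :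
    ∑' k, normalizedL2 (coverBall r k) (fun x => √(∑ i ∈ F, ‖h i x‖ ^ 2)) ≤
      gridConst * avgEnergy (boxMap 0 1 r) 1 (sqDensity F h) := by
  simp_rw [normalizedL2_sqrt, coverBall_eq_latticeTile hr]
  refine (tsum_normalized_tile_le (det_ballMap_ne_zero hr) unitCube_subset_ball
    abs_le_one_of_sum_sq_le _).trans ?_
  refine (avgEnergy_comparison (Ψ := boxMap 0 1 r) (det_boxMap_ne_zero one_pos hr) 2 1 ?_ ?_
    _).trans ?_
  · intro y hy
    refine (ballMap_abs_le_iff hr y).1 fun i => (hy i).trans (by norm_num)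
  · rw [absDet_ballMap hr, one_mul]
  · gcongr
    rw [gridConst]
    norm_num

lemma avgEnergy_le_tsum_coverBall {ι : Type*} (F : Finset ι) (h : ι → 𝓢(E3, ℂ)) {r : ℝ}
    (hr : 0 < r) :
    avgEnergy (boxMap 0 1 r) 1 (sqDensity F h) ≤
      gridConst * ∑' k, normalizedL2 (coverBall r k) (fun x => √(∑ i ∈ F, ‖h i x‖ ^ 2)) := by
  simp_rw [normalizedL2_sqrt, coverBall_eq_latticeTile hr]
  refine (avgEnergy_comparison (Ψ := ballMap r) (det_ballMap_ne_zero hr) 1 1 ?_ ?_ _).trans ?_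
  · intro y hy
    simpa using (ballMap_abs_le_iff hr y).2 hy
  · rw [absDet_ballMap hr, one_mul]
  · refine (mul_le_mul' le_rfl (avgEnergy_le_tsum_normalized_tile (det_ballMap_ne_zero hr)
      unitCube_subset_ball abs_le_one_of_sum_sq_le _)).trans ?_
    rw [← mul_assoc]
    gcongr
    rw [gridConst]
    norm_num

lemma unitCube_subset_cube : unitCube ⊆ {y | ∀ i, |y i| ≤ 1 / 2} := fun y hy i => by
  rw [abs_le]; exact ⟨(hy i).1, (hy i).2.le⟩

lemma tsum_tileU_le {ι : Type*} (F : Finset ι) (h : ι → 𝓢(E3, ℂ)) {η s ρ : ℝ} (hs : 0 < s)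
    (hs1 : s ≤ 1) (hρ : 0 < ρ) (hη : |η| ≤ 1) :
    ∑' k, normalizedL2 (tileU η s ρ k) (fun x => √(∑ i ∈ F, ‖h i x‖ ^ 2)) ≤
      gridConst * avgEnergy (boxMap η s ρ) 1 (sqDensity F h) := by
  simp_rw [normalizedL2_sqrt, tileU_eq_latticeTile hs hρ]
  refine (tsum_normalized_tile_le (det_tileMap_ne_zero hs hρ) unitCube_subset_cube
    (fun y hy i => (hy i).trans (by norm_num)) _).trans ?_
  refine (avgEnergy_comparison (Ψ := boxMap η s ρ) (det_boxMap_ne_zero hs hρ) 24 1 ?_ ?_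
    _).trans ?_
  · intro y hy i
    exact (boxMap_abs_le_of_tileMap hs hs1 hρ (by norm_num) hη y hy i).trans (by norm_num)
  · rw [absDet_tileMap hs hρ, absDet_boxMap hs hρ, one_mul]
    have : 0 < ρ ^ 3 * s ^ 3 := by positivity
    refine ENNReal.ofReal_le_ofReal (one_div_le_one_div_of_le this ?_)
    linarith
  · gcongr
    rw [gridConst]
    norm_num

lemma avgEnergy_le_tsum_tileU {ι : Type*} (F : Finset ι) (h : ι → 𝓢(E3, ℂ)) {η s ρ : ℝ}
    (hs : 0 < s) (hs1 : s ≤ 1) (hρ : 0 < ρ) (hη : |η| ≤ 1) :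
    avgEnergy (boxMap η s ρ) 1 (sqDensity F h) ≤
      gridConst * ∑' k, normalizedL2 (tileU η s ρ k) (fun x => √(∑ i ∈ F, ‖h i x‖ ^ 2)) := by
  simp_rw [normalizedL2_sqrt, tileU_eq_latticeTile hs hρ]
  refine (avgEnergy_comparison (Ψ := tileMap η s ρ) (det_tileMap_ne_zero hs hρ) 16 4 ?_ ?_
    _).trans ?_
  · intro y hy i
    exact (tileMap_abs_le_of_boxMap hs hs1 hρ (by norm_num) hη y hy i).trans (by norm_num)
  · rw [absDet_tileMap hs hρ, absDet_boxMap hs hρ, ← ENNReal.ofReal_ofNat,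
      ← ENNReal.ofReal_mul (by norm_num)]
    refine ENNReal.ofReal_le_ofReal (le_of_eq ?_)
    field_simp
  -- The loss is `4² · 35⁶ · 8 · 5⁶`, the largest of the four comparisons and the value of
  -- `gridConst`.
  · refine (mul_le_mul' le_rfl (avgEnergy_le_tsum_normalized_tile (det_tileMap_ne_zero hs hρ)
      unitCube_subset_cube (fun y hy i => (hy i).trans (by norm_num)) _)).trans ?_
    rw [← mul_assoc]
    gcongr
    rw [gridConst]
    norm_num

/-! ### Apertures and sectors -/

lemma aperture_pos {R : ℝ} (hR : 1 ≤ R) : 0 < aperture R :=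
  Real.rpow_pos_of_pos (by linarith) _

lemma aperture_le_one {R : ℝ} (hR : 1 ≤ R) : aperture R ≤ 1 :=
  Real.rpow_le_one_of_one_le_of_nonpos hR (by norm_num)

lemma aperture_sq {R : ℝ} (hR : 0 ≤ R) : aperture R ^ 2 = R⁻¹ := by
  rw [aperture, ← Real.rpow_natCast, ← Real.rpow_mul hR]
  norm_num
  exact Real.rpow_neg_one R

lemma aperture_anti {r R : ℝ} (hr : 1 ≤ r) (h : r ≤ R) : aperture R ≤ aperture r :=
  Real.rpow_le_rpow_of_nonpos (by linarith) h (by norm_num)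

lemma aperture_sq_mul {σ R : ℝ} (hσ : 0 < σ) (hR : 0 ≤ R) :
    aperture (σ ^ 2 * R) = aperture R / σ := by
  rw [aperture, Real.mul_rpow (by positivity) hR, ← Real.rpow_natCast, ← Real.rpow_mul hσ.le,
    aperture]
  norm_num
  rw [Real.rpow_neg_one]
  ring

lemma one_le_sq_mul {σ R : ℝ} (hR : 1 ≤ R) (h : aperture R ≤ σ) : 1 ≤ σ ^ 2 * R := by
  have h1 : aperture R ^ 2 ≤ σ ^ 2 := pow_le_pow_left₀ (aperture_pos hR).le h 2
  rw [aperture_sq (by linarith)] at h1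
  have h2 : R⁻¹ * R = 1 := inv_mul_cancel₀ (by linarith)
  rw [← h2]
  exact mul_le_mul_of_nonneg_right h1 (by linarith)

lemma mem_dyadicScales_pos {R s : ℝ} (hs : s ∈ dyadicScales R) : 0 < s := by
  obtain ⟨⟨k, rfl⟩, -⟩ := hs; positivity

lemma mem_dyadicScales_le_one {R s : ℝ} (hs : s ∈ dyadicScales R) : s ≤ 1 := by
  obtain ⟨⟨k, rfl⟩, -⟩ := hs
  exact pow_le_one₀ (by norm_num) (by norm_num)

/-- From `2^{-k} ≥ R^{-1/2}` follows `k log 2 ≤ (log R) / 2`, and `log 2 > 1/2`. -/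
lemma dyadicScales_subset {R : ℝ} (hR : 1 ≤ R) :
    dyadicScales R ⊆ ((Finset.range (⌊Real.log R⌋₊ + 1)).image fun k : ℕ => (1 / 2 : ℝ) ^ k) := by
  rintro s ⟨⟨k, rfl⟩, hk⟩
  rw [Finset.coe_image]
  refine ⟨k, ?_, rfl⟩
  rw [Finset.coe_range, Set.mem_Iio, Nat.lt_succ_iff, Nat.le_floor_iff (Real.log_nonneg hR)]
  have h1 := Real.log_le_log (aperture_pos hR) hk
  rw [aperture, Real.log_rpow (by linarith), Real.log_pow, one_div, Real.log_inv] at h1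
  have h2 := Real.log_two_gt_d9
  have h3 : (0 : ℝ) ≤ k := Nat.cast_nonneg k
  nlinarith

lemma finite_dyadicScales {R : ℝ} (hR : 1 ≤ R) : (dyadicScales R).Finite :=
  (Finset.finite_toSet _).subset (dyadicScales_subset hR)

lemma tsum_dyadicScales_le {R : ℝ} (hR : 1 ≤ R) (F : ℝ → ℝ≥0∞) (B : ℝ≥0∞)
    (h : ∀ s ∈ dyadicScales R, F s ≤ B) :
    ∑' s : dyadicScales R, F s ≤ ENNReal.ofReal (1 + Real.log R) * B := by
  have hfin := finite_dyadicScales hR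
  have : Fintype (dyadicScales R) := hfin.fintype
  rw [tsum_fintype]
  calc ∑ s : dyadicScales R, F s ≤ ∑ _s : dyadicScales R, B :=
        Finset.sum_le_sum fun s _ => h s s.2
    _ = (Fintype.card (dyadicScales R) : ℝ≥0∞) * B := by
        rw [Finset.sum_const, nsmul_eq_mul, Finset.card_univ]
    _ ≤ _ := by
        gcongr
        have h1 : Fintype.card (dyadicScales R) ≤ ⌊Real.log R⌋₊ + 1 := by
          rw [← Set.toFinset_card]
          have : (dyadicScales R).toFinset ⊆
              (Finset.range (⌊Real.log R⌋₊ + 1)).image fun k : ℕ => (1 / 2 : ℝ) ^ k := by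
            intro x hx
            exact_mod_cast dyadicScales_subset hR (Set.mem_toFinset.1 hx)
          refine (Finset.card_le_card this).trans (Finset.card_image_le.trans ?_)
          rw [Finset.card_range]
        rw [← ENNReal.ofReal_natCast]
        refine ENNReal.ofReal_le_ofReal ?_
        have h2 := Nat.floor_le (Real.log_nonneg hR)
        have h3 : (Fintype.card (dyadicScales R) : ℝ) ≤ (⌊Real.log R⌋₊ : ℝ) + 1 := by
          exact_mod_cast h1
        linarith

lemma ceil_ten_div_pos {s : ℝ} (hs : 0 < s) : (0 : ℝ) < (⌈10 / s⌉₊ : ℝ) := by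
  have : 0 < ⌈10 / s⌉₊ := Nat.ceil_pos.2 (by positivity)
  exact_mod_cast this

lemma abs_le_of_mem_sectorCenters {s η : ℝ} (hs : 0 < s) (hs1 : s ≤ 1)
    (h : η ∈ sectorCenters s) : |η| ≤ 1 - s := by
  obtain ⟨j, hj, rfl⟩ := Finset.mem_image.1 h
  have hN := ceil_ten_div_pos hs
  have hj' : (j : ℝ) ≤ ⌈10 / s⌉₊ := by
    exact_mod_cast Nat.lt_succ_iff.1 (Finset.mem_range.1 hj)
  have h1 : (j : ℝ) / ⌈10 / s⌉₊ ≤ 1 := by rwa [div_le_one hN]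
  have h2 : 0 ≤ (j : ℝ) / ⌈10 / s⌉₊ := by positivity
  rw [abs_mul, abs_of_nonneg (by linarith : 0 ≤ 1 - s)]
  refine mul_le_of_le_one_right (by linarith) ?_
  rw [mul_div_assoc, abs_le]
  constructor <;> linarith

lemma abs_le_one_of_mem_sectorCenters {s η : ℝ} (hs : 0 < s) (hs1 : s ≤ 1)
    (h : η ∈ sectorCenters s) : |η| ≤ 1 :=
  (abs_le_of_mem_sectorCenters hs hs1 h).trans (by linarith)

/-- Every interval of half the aperture is contained, within `[-1, 1]`, in one of the intervals that
define the sectors. -/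
lemma exists_sectorCenter {a α : ℝ} (ha : 0 < a) (_ha1 : a ≤ 1) (hα : |α| ≤ 1) :
    ∃ c ∈ sectorCenters a, |α - c| ≤ a ∧ ∀ β, |β| ≤ 1 → |β - α| ≤ a / 2 → |β - c| ≤ a := by
  have hN := ceil_ten_div_pos ha
  have hN' : 10 / a ≤ (⌈10 / a⌉₊ : ℝ) := Nat.le_ceil _
  rw [abs_le] at hα
  -- Near an end of `[-1, 1]` the extreme centre `±(1 - a)` serves, because its interval reaches the
  -- end and `β` stays in `[-1, 1]`. In the middle, consecutive centres are at most `2/N ≤ a/5`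
  -- apart, and `a/2 + a/5 ≤ a`.
  rcases le_or_gt (1 - a) α with h1 | h1
  · refine ⟨1 - a, ?_, ?_, ?_⟩
    · refine Finset.mem_image.2 ⟨⌈10 / a⌉₊, by simp, ?_⟩
      field_simp
      ring
    · rw [abs_le]; constructor <;> linarith
    · intro β hβ hβ'
      rw [abs_le] at hβ hβ' ⊢
      constructor <;> linarith
  rcases le_or_gt α (-(1 - a)) with h2 | h2
  · refine ⟨-(1 - a), ?_, ?_, ?_⟩
    · exact Finset.mem_image.2 ⟨0, by simp, by simp⟩
    · rw [abs_le]; constructor <;> linarith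
    · intro β hβ hβ'
      rw [abs_le] at hβ hβ' ⊢
      constructor <;> linarith
  have h3 : 0 < 1 - a := by linarith
  set N := ⌈10 / a⌉₊ with hNdef
  set x := (α / (1 - a) + 1) / 2 * N with hx
  have hα1 : α / (1 - a) ≤ 1 := by rw [div_le_one h3]; exact h1.le
  have hα2 : -1 ≤ α / (1 - a) := by rw [le_div_iff₀ h3]; linarith
  have hx0 : 0 ≤ x := by
    rw [hx]; exact mul_nonneg (by linarith) hN.le
  have hxN : x ≤ N := by
    rw [hx]; exact mul_le_of_le_one_left hN.le (by linarith)
  have hj1 := Nat.floor_le hx0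
  have hj2 := Nat.lt_floor_add_one x
  have hclose : |α - (1 - a) * (2 * (⌊x⌋₊ : ℝ) / N - 1)| ≤ a / 5 := by
    have e : α - (1 - a) * (2 * (⌊x⌋₊ : ℝ) / N - 1) = (1 - a) * (2 * (x - ⌊x⌋₊) / N) := by
      rw [hx]; field_simp; ring
    rw [e, abs_mul, abs_of_pos h3, abs_div, abs_of_pos hN, abs_mul, abs_of_pos two_pos,
      abs_of_nonneg (by linarith)]
    have h10 : 10 ≤ a * N := by
      rw [div_le_iff₀ ha] at hN'; linarith
    have h5 : 2 * (x - ⌊x⌋₊) / N ≤ a / 5 := by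
      rw [div_le_iff₀ hN]; linarith
    have h6 : 0 ≤ 2 * (x - ⌊x⌋₊) / N := by
      have : 0 ≤ x - ⌊x⌋₊ := by linarith
      positivity
    calc (1 - a) * (2 * (x - ⌊x⌋₊) / N) ≤ 1 * (2 * (x - ⌊x⌋₊) / N) := by gcongr; linarith
      _ ≤ a / 5 := by linarith
  refine ⟨_, Finset.mem_image.2 ⟨⌊x⌋₊, ?_, rfl⟩, ?_, ?_⟩
  · rw [Finset.mem_range, Nat.lt_succ_iff]
    exact_mod_cast hj1.trans hxN
  · linarith
  · intro β _ hβ'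
    have := abs_sub_le β α ((1 - a) * (2 * (⌊x⌋₊ : ℝ) / N - 1))
    linarith

/-- The sectors of a given aperture with centres in a given interval are boundedly many. -/
lemma card_sectorCenters_le {a x : ℝ} (ha : 0 < a) (ha1 : a ≤ 1) (L : ℕ) (F : Finset ℝ)
    (hF : F ⊆ sectorCenters a) (hx : ∀ c ∈ F, |c - x| ≤ L * a) : F.card ≤ 22 * L + 22 := by
  classical
  have hN := ceil_ten_div_pos ha
  have hN' := Nat.ceil_lt_add_one (by positivity : 0 ≤ 10 / a)
  set N := ⌈10 / a⌉₊ with hNdef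
  have hNa : a * N ≤ 11 := by
    have : a * (10 / a + 1) = 10 + a := by field_simp
    have := mul_lt_mul_of_pos_left hN' ha
    linarith
  -- The spacing `2(1 - a)/N` degenerates as `a → 1`, but for `a > 1/2` there are few centres
  -- altogether. Otherwise the spacing is at least `1/N ≥ a/11`.
  rcases lt_or_ge (1 / 2) a with h | h
  · have h1 : (N : ℝ) < 22 := by
      have : (1 / 2 : ℝ) * N < a * N := by gcongr
      linarith
    have h2 : N < 22 := by exact_mod_cast h1
    calc F.card ≤ (sectorCenters a).card := Finset.card_le_card hF
      _ ≤ (Finset.range (N + 1)).card := Finset.card_image_le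
      _ ≤ _ := by rw [Finset.card_range]; omega
  set cen : ℕ → ℝ := fun j => (1 - a) * (2 * (j : ℝ) / N - 1) with hcen
  set J := (Finset.range (N + 1)).filter fun j => cen j ∈ F with hJ
  have hFJ : F ⊆ J.image cen := by
    intro c hc
    obtain ⟨j, hj, rfl⟩ := Finset.mem_image.1 (hF hc)
    exact Finset.mem_image.2 ⟨j, Finset.mem_filter.2 ⟨hj, hc⟩, rfl⟩
  have hFc : F.card ≤ J.card := (Finset.card_le_card hFJ).trans Finset.card_image_le
  rcases J.eq_empty_or_nonempty with he | hne
  · rw [he] at hFc; simp at hFc; simp [hFc]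
  have hsub : J ⊆ Finset.Icc (J.min' hne) (J.min' hne + 22 * L) := by
    intro j hj
    have hle := J.min'_le j hj
    rw [Finset.mem_Icc]
    refine ⟨hle, ?_⟩
    have h1 := hx _ (Finset.mem_filter.1 hj).2
    have h2 := hx _ (Finset.mem_filter.1 (J.min'_mem hne)).2
    set i := J.min' hne
    have hij : (i : ℝ) ≤ j := by exact_mod_cast hle
    have e : cen j - cen i = (1 - a) * 2 * (j - i) / N := by rw [hcen]; ring
    have h3 : cen j - cen i ≤ 2 * L * a := by
      rw [abs_le] at h1 h2; linarith [h1.2, h2.1]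
    rw [e, div_le_iff₀ hN] at h3
    have h4 : (j : ℝ) - i ≤ (1 - a) * 2 * (j - i) := by nlinarith
    have hL : (0 : ℝ) ≤ L := Nat.cast_nonneg L
    have h5 : (j : ℝ) - i ≤ 22 * L := by nlinarith
    have h6 : (j : ℝ) ≤ ((i + 22 * L : ℕ) : ℝ) := by push_cast; linarith
    exact_mod_cast h6
  have := Finset.card_le_card hsub
  rw [Nat.card_Icc] at this
  omega

lemma conePoint_mem {K η η' s : ℝ} (hK : 10 ≤ K) (hη : |η| ≤ 1) (h : |η - η'| ≤ s) :
    (!₂[η ^ 2 / 2, η, 1] : E3) ∈ surfaceSector K η' s := by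
  have : (0 : ℝ) ≤ 1 / K := by positivity
  simp only [surfaceSector, coneArc, Set.mem_ofPred_eq, Matrix.cons_val, div_one]
  exact ⟨⟨by ring, by linarith, le_rfl, hη⟩, h⟩

lemma coneArc_two_ge {K : ℝ} (hK : 10 ≤ K) {x : E3} (hx : x ∈ coneArc K) : 9 / 10 ≤ x 2 := by
  have : 1 / K ≤ 1 / 10 := by gcongr
  linarith [hx.2.1]

/-- Sectors that meet have nearby centres. -/
lemma abs_sub_le_of_sectors_meet {K η η' s s' : ℝ} (hK : 10 ≤ K) (hs : 0 < s) (hs1 : s ≤ 1)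
    (hs' : 0 < s') (hs1' : s' ≤ 1) (h : (sector K η s ∩ sector K η' s').Nonempty) :
    |η - η'| ≤ 5 * (s + s') := by
  obtain ⟨z, hz, hz'⟩ := h
  have aux : ∀ {η s : ℝ}, 0 < s → z ∈ sector K η s → ∃ x ∈ surfaceSector K η s,
      dist z x < 3 / 2 * s ^ 2 := by
    intro η s hs hz
    have h1 : z ∈ Metric.thickening (3 / 2 * s ^ 2) (surfaceSector K η s) :=
      Metric.cthickening_subset_thickening' (by positivity) (by nlinarith [pow_pos hs 2]) _ hz
    exact Metric.mem_thickening_iff.1 h1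
  obtain ⟨x, hx, hzx⟩ := aux hs hz
  obtain ⟨y, hy, hzy⟩ := aux hs' hz'
  have hxy : dist x y ≤ 3 / 2 * (s + s') := by
    have h1 := dist_triangle_left x y z
    nlinarith
  have hd : ∀ i, |x i - y i| ≤ dist x y := fun i => by
    have := PiLp.norm_apply_le (x - y) i
    rwa [dist_eq_norm, ← Real.norm_eq_abs]
  have hx2 := coneArc_two_ge hK hx.1
  have hy2 := coneArc_two_ge hK hy.1
  have hyr := hy.1.2.2.2
  -- Since `ν₃ ≥ 9/10` and `|ν₂/ν₃| ≤ 1`, the ratio is Lipschitz with constant `20/9`. The total is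
  -- `1 + (20/9)(3/2) ≤ 5` times `s + s'`.
  have e : x 1 / x 2 - y 1 / y 2 = ((x 1 - y 1) - (y 1 / y 2) * (x 2 - y 2)) / x 2 := by
    have : x 2 ≠ 0 := by linarith
    have : y 2 ≠ 0 := by linarith
    field_simp
    ring
  have h1 : |x 1 / x 2 - y 1 / y 2| ≤ 20 / 9 * dist x y := by
    rw [e, abs_div, abs_of_pos (by linarith : 0 < x 2), div_le_iff₀ (by linarith)]
    have h2 : |(x 1 - y 1) - (y 1 / y 2) * (x 2 - y 2)| ≤ dist x y + 1 * dist x y := by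
      refine (abs_sub _ _).trans ?_
      rw [abs_mul]
      gcongr
      · exact hd 1
      · exact hd 2
    have : 0 ≤ dist x y := dist_nonneg
    nlinarith
  have h2 := hx.2
  have h3 := hy.2
  have h4 : |η - η'| ≤ |x 1 / x 2 - η| + |x 1 / x 2 - y 1 / y 2| + |y 1 / y 2 - η'| := by
    have := abs_add_three (-(x 1 / x 2 - η)) (x 1 / x 2 - y 1 / y 2) (y 1 / y 2 - η')
    rw [abs_neg] at this
    refine le_trans (le_of_eq ?_) this
    congr 1
    ring
  linarith

/-- The intermediate applications of the inequality need assignments of their own. The cone point at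
height `ν₃ = 1` over the centre of `θ` lies in `θ` and in a sector of each coarser aperture. -/
lemma exists_isSectorAssignment {K R : ℝ} (hK : 10 ≤ K) (hR : 1 ≤ R) :
    ∃ par, IsSectorAssignment K R par := by
  classical
  have ha := aperture_pos hR
  have key : ∀ s η : ℝ, ∃ c, aperture R ≤ s → s ≤ 1 → η ∈ sectorCenters (aperture R) →
      c ∈ sectorCenters s ∧ (sector K η (aperture R) ∩ sector K c s).Nonempty := by
    intro s η
    by_cases h : aperture R ≤ s ∧ s ≤ 1 ∧ η ∈ sectorCenters (aperture R)
    · have hη := abs_le_one_of_mem_sectorCenters ha (aperture_le_one hR) h.2.2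
      obtain ⟨c, hc, hc', -⟩ := exists_sectorCenter (ha.trans_le h.1) h.2.1 hη
      refine ⟨c, fun _ _ _ => ⟨hc, !₂[η ^ 2 / 2, η, 1], ?_, ?_⟩⟩
      · exact Metric.self_subset_cthickening _ (conePoint_mem hK hη (by simpa using ha.le))
      · exact Metric.self_subset_cthickening _ (conePoint_mem hK hη hc')
    · exact ⟨0, fun h1 h2 h3 => absurd ⟨h1, h2, h3⟩ h⟩
  choose c hc using key
  refine ⟨fun s η => if s = aperture R then η else c s η, fun η _ => by simp, ?_⟩
  intro s h1 h2 η hη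
  by_cases hs : s = aperture R
  · subst hs
    simp only [if_true, Set.inter_self]
    refine ⟨hη, !₂[η ^ 2 / 2, η, 1], Metric.self_subset_cthickening _ (conePoint_mem hK ?_ ?_)⟩
    · exact abs_le_one_of_mem_sectorCenters ha (aperture_le_one hR) hη
    · simpa using ha.le
  · simp only [if_neg hs]
    exact hc s η h1 h2 hη

lemma abs_sub_le_of_assignment {K R : ℝ} {par : ℝ → ℝ → ℝ} (hK : 10 ≤ K) (hR : 1 ≤ R)
    (h : IsSectorAssignment K R par) {s η : ℝ} (hs : aperture R ≤ s) (hs1 : s ≤ 1)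
    (hη : η ∈ sectorCenters (aperture R)) : |η - par s η| ≤ 10 * s := by
  have ha := aperture_pos hR
  have := abs_sub_le_of_sectors_meet hK ha (aperture_le_one hR) (ha.trans_le hs) hs1
    (h.2 s hs hs1 η hη).2
  linarith

/-! ### The infimum defining `SK` is attained -/

lemma lintegral_eq_zero_of_avgEnergy_eq_zero {Φ : E3 →ₗ[ℝ] E3} (h : LinearMap.det Φ ≠ 0)
    {S : E3 → ℝ≥0∞} (hS : avgEnergy Φ 1 S = 0) : ∫⁻ x, S x = 0 := by
  have h3 := tsum_tile_le_avgEnergy h (Y := unitCube) (ρ := 1 / 2)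
    (fun y hy i => by rw [abs_le]; exact ⟨(hy i).1, (hy i).2.le⟩) S
  norm_num only at h3
  rw [hS, nonpos_iff_eq_zero, mul_eq_zero] at h3
  have h4 := ENNReal.tsum_eq_zero.1 (h3.resolve_left (absDet_ne_zero h))
  rw [lintegral_eq_tsum_cell Φ, ENNReal.tsum_eq_zero]
  exact fun k => pow_eq_zero_iff (two_ne_zero) |>.1 (h4 k)

/-- There is only one sector of aperture one, so every `θ` is assigned to it, and the term `s = 1`
alone forces all pieces to vanish. This settles the case `SK = ⊤`, where `⊤ * 0 = 0` makes the
inequality a real claim. -/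
lemma ballSum_eq_zero_of_boxSum_eq_zero {K r R : ℝ} (hR : 1 ≤ R) {g : ℝ → 𝓢(E3, ℂ)}
    {par : ℝ → ℝ → ℝ} (h : IsSectorAssignment K R par) (h0 : boxSum R g par = 0) :
    ballSum r R g par = 0 := by
  have h1mem : (1 : ℝ) ∈ dyadicScales R := ⟨⟨0, by simp⟩, aperture_le_one hR⟩
  have hc : ∀ c ∈ sectorCenters 1, c = 0 := by
    intro c hc
    have := abs_le_of_mem_sectorCenters one_pos le_rfl hc
    simpa using this
  have h0mem : (0 : ℝ) ∈ sectorCenters 1 := Finset.mem_image.2 ⟨0, by simp, by simp⟩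
  have hch : children R par 1 0 = sectorCenters (aperture R) := by
    rw [children, Finset.filter_eq_self]
    exact fun η hη => hc _ (h.2 1 (aperture_le_one hR) le_rfl η hη).1
  have h1 : ∑' k, normalizedL2 (tileU 0 1 R k) (boxSquareFn R g par 1 0) = 0 := by
    have h2 := ENNReal.tsum_eq_zero.1 h0 ⟨1, h1mem⟩
    exact (Finset.sum_eq_zero_iff.1 h2) 0 h0mem
  have h2 : avgEnergy (boxMap 0 1 R) 1 (sqDensity (children R par 1 0) g) = 0 := by
    have := avgEnergy_le_tsum_tileU (children R par 1 0) g (η := 0) one_pos le_rfl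
      (by linarith : 0 < R) (by simp)
    refine nonpos_iff_eq_zero.1 (this.trans (le_of_eq ?_))
    rw [mul_eq_zero]
    exact Or.inr h1
  have h3 := lintegral_eq_zero_of_avgEnergy_eq_zero
    (det_boxMap_ne_zero one_pos (by linarith)) h2
  rw [hch, lintegral_eq_zero_iff (measurable_sqDensity _ _)] at h3
  refine ENNReal.tsum_eq_zero.2 fun k => ?_
  have h4 := normalizedL2_sqrt (sectorCenters (aperture r)) (sectorPiece R g par (aperture r))
    (coverBall r k)
  refine h4.trans ?_
  have h5 : sqDensity (sectorCenters (aperture r)) (sectorPiece R g par (aperture r))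
      =ᵐ[volume] 0 := by
    filter_upwards [h3] with x hx
    refine Finset.sum_eq_zero fun η _ => ?_
    have h6 : ∀ θ ∈ sectorCenters (aperture R), g θ x = 0 := by
      intro θ hθ
      simpa using Finset.sum_eq_zero_iff.1 hx θ hθ
    have h7 : sectorPiece R g par (aperture r) η x = 0 := by
      rw [sectorPiece, sum_apply]
      exact Finset.sum_eq_zero fun θ hθ => h6 θ (Finset.mem_filter.1 hθ).1
    rw [h7]; simp
  rw [lintegral_congr_ae (ae_restrict_of_ae h5)]
  simp

/-- The constant `SK` satisfies the inequality that defines it. -/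
lemma ballSum_le_SK_mul {K r R : ℝ} (hR : 1 ≤ R) {f : 𝓢(E3, ℂ)} {g : ℝ → 𝓢(E3, ℂ)}
    {par : ℝ → ℝ → ℝ}
    (h1 : tsupport (𝓕 f : 𝓢(E3, ℂ)) ⊆ Metric.cthickening R⁻¹ (coneArc K))
    (h2 : IsSectorDecomposition K R f g) (h3 : IsSectorAssignment K R par) :
    ballSum r R g par ≤ SK K r R * boxSum R g par := by
  -- Dividing by the box sum requires it to be finite, which holds because Schwartz functions are in
  -- `L²` and there are finitely many scales and sectors.
  have hfin : boxSum R g par ≠ ⊤ := by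
    have : Fintype (dyadicScales R) := (finite_dyadicScales hR).fintype
    unfold boxSum
    rw [tsum_fintype]
    refine (ENNReal.sum_lt_top.2 fun s _ => ENNReal.sum_lt_top.2 fun η hη => ?_).ne
    have hs := mem_dyadicScales_pos s.2
    have hs1 := mem_dyadicScales_le_one s.2
    refine (tsum_tileU_le (children R par s η) g hs hs1 (by linarith)
      (abs_le_one_of_mem_sectorCenters hs hs1 hη)).trans_lt ?_
    exact ENNReal.mul_lt_top (ENNReal.natCast_lt_top _)
      (avgEnergy_one_lt_top (det_boxMap_ne_zero hs (by linarith)) (lintegral_sqDensity_ne_top _ _))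
  rcases eq_or_ne (boxSum R g par) 0 with h0 | h0
  · rw [ballSum_eq_zero_of_boxSum_eq_zero hR h3 h0]
    exact zero_le
  · rw [← ENNReal.div_le_iff h0 hfin]
    refine le_sInf fun C hC => ?_
    rw [ENNReal.div_le_iff h0 hfin]
    exact hC f g par h1 h2 h3

/-! ### Lorentz rescaling -/

/-- The Lorentz transformation that preserves the cone and the coordinate `ν₃`, and maps the ratio
`ν₂ / ν₃` to `(ν₂ / ν₃ - η₀) / t`. -/
noncomputable def lorentz (η₀ t : ℝ) : E3 →ₗ[ℝ] E3 :=
  Matrix.toLpLin 2 2 !![t⁻¹ ^ 2, -(t⁻¹ ^ 2 * η₀), t⁻¹ ^ 2 * (η₀ ^ 2 / 2); 0, t⁻¹, -(t⁻¹ * η₀);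
    0, 0, 1]

lemma lorentz_zero (η₀ t : ℝ) (x : E3) :
    lorentz η₀ t x 0 = t⁻¹ ^ 2 * (x 0 - η₀ * x 1 + η₀ ^ 2 / 2 * x 2) := by
  simp [lorentz, Matrix.mulVec, dotProduct, Fin.sum_univ_three]
  ring

lemma lorentz_one (η₀ t : ℝ) (x : E3) : lorentz η₀ t x 1 = t⁻¹ * (x 1 - η₀ * x 2) := by
  simp [lorentz, Matrix.mulVec, dotProduct, Fin.sum_univ_three]
  ring

lemma lorentz_two (η₀ t : ℝ) (x : E3) : lorentz η₀ t x 2 = x 2 := by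
  simp [lorentz, Matrix.mulVec, dotProduct, Fin.sum_univ_three]

/-- The transpose of `lorentz`. -/
noncomputable def lorentzTLin (η₀ t : ℝ) : E3 →ₗ[ℝ] E3 :=
  Matrix.toLpLin 2 2 !![t⁻¹ ^ 2, 0, 0; -(t⁻¹ ^ 2 * η₀), t⁻¹, 0;
    t⁻¹ ^ 2 * (η₀ ^ 2 / 2), -(t⁻¹ * η₀), 1]

lemma lorentzTLin_zero (η₀ t : ℝ) (x : E3) : lorentzTLin η₀ t x 0 = t⁻¹ ^ 2 * x 0 := by
  simp [lorentzTLin, Matrix.mulVec, dotProduct, Fin.sum_univ_three]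

lemma lorentzTLin_one (η₀ t : ℝ) (x : E3) :
    lorentzTLin η₀ t x 1 = -(t⁻¹ ^ 2 * η₀ * x 0) + t⁻¹ * x 1 := by
  simp [lorentzTLin, Matrix.mulVec, dotProduct, Fin.sum_univ_three]

lemma lorentzTLin_two (η₀ t : ℝ) (x : E3) :
    lorentzTLin η₀ t x 2 = t⁻¹ ^ 2 * (η₀ ^ 2 / 2) * x 0 - t⁻¹ * η₀ * x 1 + x 2 := by
  simp [lorentzTLin, Matrix.mulVec, dotProduct, Fin.sum_univ_three]
  ring

lemma det_lorentzTLin (η₀ t : ℝ) : LinearMap.det (lorentzTLin η₀ t) = t⁻¹ ^ 3 := by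
  rw [lorentzTLin, LinearMap.det_toLpLin, Matrix.det_fin_three]
  simp
  ring

lemma inner_lorentz (η₀ t : ℝ) (x y : E3) : ⟪lorentz η₀ t x, y⟫ = ⟪x, lorentzTLin η₀ t y⟫ := by
  simp only [PiLp.inner_apply, Fin.sum_univ_three, RCLike.inner_apply, conj_trivial, lorentz_zero,
    lorentz_one, lorentz_two, lorentzTLin_zero, lorentzTLin_one, lorentzTLin_two]
  ring

/-- The transpose of `lorentz`, as an equivalence. -/
noncomputable def lorentzT (η₀ t : ℝ) (ht : t ≠ 0) : E3 ≃L[ℝ] E3 :=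
  ((lorentzTLin η₀ t).equivOfDetNeZero
    (by rw [det_lorentzTLin]; positivity)).toContinuousLinearEquiv

lemma lorentzT_apply (η₀ t : ℝ) (ht : t ≠ 0) (x : E3) :
    lorentzT η₀ t ht x = lorentzTLin η₀ t x := rfl

lemma lorentz_surjective (η₀ : ℝ) {t : ℝ} (ht : t ≠ 0) : Function.Surjective (lorentz η₀ t) := by
  have h : LinearMap.det (lorentz η₀ t) ≠ 0 := by
    rw [lorentz, LinearMap.det_toLpLin, Matrix.det_fin_three]
    simp [ht]
  exact (LinearMap.equivOfDetNeZero _ h).surjective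

/-- The Lorentz map `L` sends `γ(η)` to `γ((η - η₀)/t)`. Differentiating in `η`, it sends `γ'` and
`γ''` to `t⁻¹` and `t⁻²` times the frame vectors at the new parameter. Pairing with `Lᵀ x` therefore
matches the sides exactly when the aperture is multiplied by `t` and the scale divided by `t²`. -/
lemma boxMap_comp_lorentzT (η η₀ s ρ : ℝ) {t : ℝ} (ht : t ≠ 0) :
    boxMap η (t * s) (ρ / t ^ 2) ∘ₗ (lorentzT η₀ t ht).toLinearEquiv =
      boxMap ((η - η₀) / t) s ρ := by
  ext x i
  change boxMap η (t * s) (ρ / t ^ 2) (lorentzTLin η₀ t x) i = _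
  fin_cases i
  · change boxMap η (t * s) (ρ / t ^ 2) (lorentzTLin η₀ t x) 0 = boxMap ((η - η₀) / t) s ρ x 0
    rw [boxMap_zero, boxMap_zero, lorentzTLin_zero, lorentzTLin_one, lorentzTLin_two]
    rw [show ρ / t ^ 2 * (t * s) ^ 2 = ρ * s ^ 2 by field_simp]
    congr 1
    field_simp
    ring
  · change boxMap η (t * s) (ρ / t ^ 2) (lorentzTLin η₀ t x) 1 = boxMap ((η - η₀) / t) s ρ x 1
    rw [boxMap_one, boxMap_one, lorentzTLin_zero, lorentzTLin_one]
    rw [show ρ / t ^ 2 * (t * s) = ρ * s / t by field_simp, div_div_eq_mul_div]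
    congr 1
    field_simp
    ring
  · change boxMap η (t * s) (ρ / t ^ 2) (lorentzTLin η₀ t x) 2 = boxMap ((η - η₀) / t) s ρ x 2
    rw [boxMap_two, boxMap_two, lorentzTLin_zero]
    field_simp

lemma avgEnergy_lorentz (η η₀ s ρ : ℝ) {t : ℝ} (ht : t ≠ 0) (S : E3 → ℝ≥0∞) :
    absDet (lorentzT η₀ t ht).toLinearEquiv *
      avgEnergy (boxMap ((η - η₀) / t) s ρ) 1 (fun x => S (lorentzT η₀ t ht x)) =
      avgEnergy (boxMap η (t * s) (ρ / t ^ 2)) 1 S := by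
  rw [← boxMap_comp_lorentzT η η₀ s ρ ht]
  exact avgEnergy_comp _ _ _ _

/-- The bound `4/t²` is tuned to `t = 2σ`: it turns the thickness `a²` of a sector into `(a/σ)²`,
the thickness belonging to the aperture `a/σ`. For `t = 2`, `η₀ = 0` the map is `diag(1/4, 1/2, 1)`,
with norm `1 = 4/t²`. -/
lemma lorentz_norm_le {η₀ t : ℝ} (ht : 0 < t)
    (h : (t ≤ 1 ∧ |η₀| ≤ 1) ∨ (t = 2 ∧ η₀ = 0)) (w : E3) :
    ‖lorentz η₀ t w‖ ≤ 4 / t ^ 2 * ‖w‖ := by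
  have h0 : 0 ≤ 4 / t ^ 2 * ‖w‖ := by positivity
  refine le_of_sq_le_sq ?_ h0
  rw [mul_pow, EuclideanSpace.norm_sq_eq, EuclideanSpace.norm_sq_eq, Fin.sum_univ_three,
    Fin.sum_univ_three]
  simp only [Real.norm_eq_abs, sq_abs, lorentz_zero, lorentz_one, lorentz_two]
  rcases h with ⟨ht1, hη⟩ | ⟨rfl, rfl⟩
  · have hη2 : η₀ ^ 2 ≤ 1 := by
      rw [← sq_abs]; exact pow_le_one₀ (abs_nonneg _) hη
    set u := t⁻¹ with hu
    have hu1 : 1 ≤ u ^ 2 := one_le_pow₀ (by rw [hu]; exact (one_le_inv₀ ht).2 ht1)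
    have e : (4 / t ^ 2) ^ 2 = 16 * (u ^ 2) ^ 2 := by rw [hu]; field_simp; norm_num
    rw [e]
    set v := u ^ 2 with hv
    have hvv : v ≤ v ^ 2 := by nlinarith
    have a0 := sq_nonneg (w 0)
    have a1 := sq_nonneg (w 1)
    have a2 := sq_nonneg (w 2)
    have b1 : (η₀ * w 1) ^ 2 ≤ w 1 ^ 2 := by
      rw [mul_pow]; exact mul_le_of_le_one_left a1 hη2
    have b2 : (η₀ * w 2) ^ 2 ≤ w 2 ^ 2 := by
      rw [mul_pow]; exact mul_le_of_le_one_left a2 hη2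
    have b3 : (η₀ ^ 2 / 2 * w 2) ^ 2 ≤ w 2 ^ 2 := by
      rw [mul_pow]
      refine mul_le_of_le_one_left a2 ?_
      exact pow_le_one₀ (by positivity) (by linarith)
    have c0 : (w 0 - η₀ * w 1 + η₀ ^ 2 / 2 * w 2) ^ 2 ≤ 3 * (w 0 ^ 2 + w 1 ^ 2 + w 2 ^ 2) := by
      nlinarith [sq_nonneg (w 0 + η₀ * w 1), sq_nonneg (w 0 - η₀ ^ 2 / 2 * w 2),
        sq_nonneg (η₀ * w 1 + η₀ ^ 2 / 2 * w 2)]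
    have c1 : (w 1 - η₀ * w 2) ^ 2 ≤ 2 * (w 0 ^ 2 + w 1 ^ 2 + w 2 ^ 2) := by
      nlinarith [sq_nonneg (w 1 + η₀ * w 2)]
    set W := w 0 ^ 2 + w 1 ^ 2 + w 2 ^ 2 with hW
    have hW0 : 0 ≤ W := by positivity
    calc _ = v ^ 2 * (w 0 - η₀ * w 1 + η₀ ^ 2 / 2 * w 2) ^ 2 + v * (w 1 - η₀ * w 2) ^ 2
            + w 2 ^ 2 := by rw [hv]; ring
      _ ≤ v ^ 2 * (3 * W) + v ^ 2 * (2 * W) + v ^ 2 * W := by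
          gcongr
          calc w 2 ^ 2 ≤ 1 * W := by rw [hW]; linarith
            _ ≤ v ^ 2 * W := by
              gcongr
              exact hu1.trans hvv
      _ ≤ 16 * v ^ 2 * W := by nlinarith [sq_nonneg v]
  · norm_num
    nlinarith [sq_nonneg (w 0), sq_nonneg (w 1), sq_nonneg (w 2)]

/-- The composition of a Schwartz function with the transpose of a Lorentz transformation. -/
noncomputable def compLorentz (η₀ t : ℝ) (ht : t ≠ 0) : 𝓢(E3, ℂ) →L[ℂ] 𝓢(E3, ℂ) :=
  SchwartzMap.compCLMOfContinuousLinearEquiv ℂ (lorentzT η₀ t ht)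

lemma compLorentz_apply (η₀ t : ℝ) (ht : t ≠ 0) (g : 𝓢(E3, ℂ)) (x : E3) :
    compLorentz η₀ t ht g x = g (lorentzT η₀ t ht x) := rfl

/-- By change of variables, the transform of `g ∘ Lᵀ` at `L ζ` is a constant multiple of that of `g`
at `ζ`. Only its vanishing matters for supports. -/
lemma fourier_compLorentz (η₀ t : ℝ) (ht : t ≠ 0) (g : 𝓢(E3, ℂ)) (ζ : E3)
    (h : (𝓕 (compLorentz η₀ t ht g) : 𝓢(E3, ℂ)) (lorentz η₀ t ζ) ≠ 0) :
    (𝓕 g : 𝓢(E3, ℂ)) ζ ≠ 0 := by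
  intro h0
  refine h ?_
  rw [SchwartzMap.fourier_coe, Real.fourier_eq] at h0 ⊢
  have hdet : LinearMap.det (lorentzTLin η₀ t) ≠ 0 := by
    rw [det_lorentzTLin]; positivity
  have hemb : MeasurableEmbedding (lorentzT η₀ t ht) :=
    (lorentzT η₀ t ht).toHomeomorph.measurableEmbedding
  have hmap : Measure.map (lorentzT η₀ t ht) volume =
      ENNReal.ofReal |(LinearMap.det (lorentzTLin η₀ t))⁻¹| • (volume : Measure E3) :=
    Measure.map_linearMap_addHaar_eq_smul_addHaar (volume : Measure E3) hdet
  have e : ∀ v : E3, Real.fourierChar (-⟪v, lorentz η₀ t ζ⟫) • compLorentz η₀ t ht g v =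
      (fun y => Real.fourierChar (-⟪y, ζ⟫) • g y) (lorentzT η₀ t ht v) := by
    intro v
    simp only [compLorentz_apply, lorentzT_apply]
    rw [real_inner_comm, inner_lorentz, real_inner_comm]
  refine (integral_congr_ae (Filter.Eventually.of_forall e)).trans ?_
  refine (hemb.integral_map (μ := volume) fun y => Real.fourierChar (-⟪y, ζ⟫) • g y).symm.trans ?_
  rw [hmap, integral_smul_measure, h0, smul_zero]

/-- The form `2ν₁ν₃ - ν₂²` is multiplied by `t⁻²` and `ν₃` is unchanged, so the truncation in `ν₃`,
and with it `K`, is preserved. -/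
lemma lorentz_mem_surfaceSector {K η₀ t θ a c a' : ℝ} (hK : 10 ≤ K) (ht : t ≠ 0)
    (h : ∀ y, |y| ≤ 1 → |y - θ| ≤ a → |(y - η₀) / t| ≤ 1 ∧ |(y - η₀) / t - c| ≤ a') {x : E3}
    (hx : x ∈ surfaceSector K θ a) : lorentz η₀ t x ∈ surfaceSector K c a' := by
  have hx2 := coneArc_two_ge hK hx.1
  have hx2' : x 2 ≠ 0 := by linarith
  obtain ⟨⟨h1, h2, h3, h4⟩, h5⟩ := hx
  have e : t⁻¹ * (x 1 - η₀ * x 2) / x 2 = (x 1 / x 2 - η₀) / t := by field_simp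
  have := h _ h4 h5
  refine ⟨⟨?_, ?_, ?_, ?_⟩, ?_⟩
  · rw [lorentz_zero, lorentz_one, lorentz_two]
    linear_combination t⁻¹ ^ 2 * h1
  · rwa [lorentz_two]
  · rwa [lorentz_two]
  · rw [lorentz_one, lorentz_two, e]; exact this.1
  · rw [lorentz_one, lorentz_two, e]; exact this.2

/-- Lorentz rescaling maps sectors into sectors. -/
lemma tsupport_compLorentz_subset {K η₀ t θ a c a' Λ : ℝ} (hK : 10 ≤ K) (ht : t ≠ 0) (hΛ : 0 < Λ)
    (h : ∀ y, |y| ≤ 1 → |y - θ| ≤ a → |(y - η₀) / t| ≤ 1 ∧ |(y - η₀) / t - c| ≤ a')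
    (hn : ∀ w, ‖lorentz η₀ t w‖ ≤ Λ * ‖w‖) (ha : Λ * a ^ 2 ≤ a' ^ 2) {g : 𝓢(E3, ℂ)}
    (hg : tsupport (𝓕 g : 𝓢(E3, ℂ)) ⊆ sector K θ a) :
    tsupport (𝓕 (compLorentz η₀ t ht g) : 𝓢(E3, ℂ)) ⊆ sector K c a' := by
  refine closure_minimal ?_ Metric.isClosed_cthickening
  intro ξ hξ
  obtain ⟨ζ, rfl⟩ := lorentz_surjective η₀ ht ξ
  have hζ : ζ ∈ sector K θ a :=
    hg (subset_tsupport _ (fourier_compLorentz η₀ t ht g ζ hξ))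
  rw [sector, Metric.mem_cthickening_iff] at hζ ⊢
  have hΛ0 : ENNReal.ofReal Λ ≠ 0 := by simpa using hΛ
  have h1 : Metric.infEDist (lorentz η₀ t ζ) (surfaceSector K c a') / ENNReal.ofReal Λ ≤
      Metric.infEDist ζ (surfaceSector K θ a) := by
    refine Metric.le_infEDist.2 fun x hx => ?_
    refine ENNReal.div_le_of_le_mul' ?_
    refine (Metric.infEDist_le_edist_of_mem (lorentz_mem_surfaceSector hK ht h hx)).trans ?_
    rw [edist_dist, edist_dist, ← ENNReal.ofReal_mul hΛ.le, dist_eq_norm, dist_eq_norm, ← map_sub]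
    exact ENNReal.ofReal_le_ofReal (hn _)
  have h2 := h1.trans hζ
  rw [ENNReal.div_le_iff hΛ0 ENNReal.ofReal_ne_top, ← ENNReal.ofReal_mul (by positivity)] at h2
  exact h2.trans (ENNReal.ofReal_le_ofReal (by linarith))

/-! ### The multiscale inequality for regrouped families -/

lemma tsupport_fourier_sum_subset {ι : Type*} (F : Finset ι) (h : ι → 𝓢(E3, ℂ)) {X : Set E3}
    (hX : IsClosed X) (hF : ∀ i ∈ F, tsupport (𝓕 (h i) : 𝓢(E3, ℂ)) ⊆ X) :
    tsupport (𝓕 (∑ i ∈ F, h i) : 𝓢(E3, ℂ)) ⊆ X := by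
  refine closure_minimal ?_ hX
  intro ξ hξ
  by_contra hn
  refine hξ ?_
  have e : 𝓕 (∑ i ∈ F, h i) = ∑ i ∈ F, (𝓕 (h i) : 𝓢(E3, ℂ)) := by
    simp_rw [← SchwartzMap.fourierTransformCLM_apply (𝕜 := ℂ)]
    exact map_sum _ _ _
  rw [e, sum_apply]
  refine Finset.sum_eq_zero fun i hi => ?_
  by_contra h0
  exact hn (hF i hi (subset_tsupport _ h0))

lemma exists_injOn_nat {α : Type*} (L : Finset α) {M : ℕ} (hL : L.card ≤ M) :
    ∃ e : α → ℕ, Set.InjOn e L ∧ ∀ b ∈ L, e b < M := by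
  classical
  refine ⟨fun b => if h : b ∈ L then (L.equivFin ⟨b, h⟩ : ℕ) else 0, ?_, ?_⟩
  · intro b hb b' hb' h
    rw [Finset.mem_coe] at hb hb'
    simp only [dif_pos hb, dif_pos hb'] at h
    simpa using L.equivFin.injective (Fin.ext h)
  · intro b hb
    simp only [dif_pos hb]
    exact (L.equivFin ⟨b, hb⟩).2.trans_le hL

lemma enorm_sum_sq_le {ι : Type*} (F : Finset ι) (z : ι → ℂ) :
    ‖∑ i ∈ F, z i‖ₑ ^ 2 ≤ F.card * ∑ i ∈ F, ‖z i‖ₑ ^ 2 :=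
  (pow_le_pow_left₀ (by simp) (enorm_sum_le _ _) 2).trans (ENNReal.sq_sum_le_card_mul_sum_sq _ _)

/-- Regrouping: a finite family with labels `p`, and with a second system of labels `q` such that
boundedly many labels of the one kind go with each label of the other kind, splits into boundedly
many subfamilies in which `q` determines `p`. -/
lemma exists_regrouping (I B Q : Finset ℝ) (p q : ℝ → ℝ) (M : ℕ) (hp : ∀ θ ∈ I, p θ ∈ B)
    (hq : ∀ θ ∈ I, q θ ∈ Q)
    (hM : ∀ y, ((I.filter fun θ => q θ = y).image p).card ≤ M)
    (hM' : ∀ b, ((I.filter fun θ => p θ = b).image q).card ≤ M) :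
    ∃ J : ℕ → Finset ℝ, (∀ i, J i ⊆ I) ∧ ∀ z : ℝ → ℂ,
      ∑ b ∈ B, ‖∑ θ ∈ I with p θ = b, z θ‖ₑ ^ 2 ≤
        M * ∑ i ∈ Finset.range M, ∑ y ∈ Q, ‖∑ θ ∈ J i with q θ = y, z θ‖ₑ ^ 2 := by
  classical
  -- For each `q`-label `y`, the at most `M` values of `p` that occur with it are numbered
  -- injectively by `e y`. The subfamily `J i` keeps those `θ` whose `p`-label has number `i`, so on
  -- `J i` the label `q` determines `p`.
  set lab : ℝ → Finset ℝ := fun y => (I.filter fun θ => q θ = y).image p with hlab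
  choose e he he' using fun y => exists_injOn_nat (lab y) (hM y)
  set J : ℕ → Finset ℝ := fun i => I.filter fun θ => e (q θ) (p θ) = i with hJ
  refine ⟨J, fun i => Finset.filter_subset _ _, fun z => ?_⟩
  have hmem : ∀ {θ}, θ ∈ I → p θ ∈ lab (q θ) := fun {θ} hθ =>
    Finset.mem_image.2 ⟨θ, Finset.mem_filter.2 ⟨hθ, rfl⟩, rfl⟩
  have h1 : ∀ b ∈ B, ‖∑ θ ∈ I with p θ = b, z θ‖ₑ ^ 2 ≤
      M * ∑ y ∈ (I.filter fun θ => p θ = b).image q,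
        ‖∑ θ ∈ J (e y b) with q θ = y, z θ‖ₑ ^ 2 := by
    intro b _
    rw [← Finset.sum_fiberwise_of_maps_to (t := (I.filter fun θ => p θ = b).image q) (g := q)
      (fun θ hθ => Finset.mem_image_of_mem q hθ)]
    refine (enorm_sum_sq_le _ _).trans ?_
    gcongr with y hy
    · exact_mod_cast hM' b
    · refine le_of_eq (congrArg (fun w : ℂ => ‖w‖ₑ) (Finset.sum_congr ?_ fun _ _ => rfl))
      obtain ⟨θ₀, hθ₀, rfl⟩ := Finset.mem_image.1 hy
      obtain ⟨hθ₀I, rfl⟩ := Finset.mem_filter.1 hθ₀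
      ext θ
      simp only [hJ, Finset.mem_filter]
      constructor
      · rintro ⟨⟨h1, h2⟩, h3⟩
        exact ⟨⟨h1, by rw [h3, h2]⟩, h3⟩
      · rintro ⟨⟨h1, h2⟩, h3⟩
        refine ⟨⟨h1, ?_⟩, h3⟩
        rw [h3] at h2
        refine he (q θ₀) ?_ (hmem hθ₀I) h2
        rw [← h3]
        exact hmem h1
  refine (Finset.sum_le_sum h1).trans ?_
  rw [← Finset.mul_sum]
  gcongr
  have h2 : ∑ b ∈ B, ∑ y ∈ (I.filter fun θ => p θ = b).image q,
      ‖∑ θ ∈ J (e y b) with q θ = y, z θ‖ₑ ^ 2 =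
      ∑ y ∈ Q, ∑ b ∈ lab y, ‖∑ θ ∈ J (e y b) with q θ = y, z θ‖ₑ ^ 2 := by
    refine Finset.sum_comm' fun b y => ?_
    simp only [hlab, Finset.mem_image, Finset.mem_filter]
    constructor
    · rintro ⟨-, θ, ⟨h1, h2⟩, h3⟩
      exact ⟨⟨θ, ⟨h1, h3⟩, h2⟩, h3 ▸ hq θ h1⟩
    · rintro ⟨⟨θ, ⟨h1, h2⟩, h3⟩, -⟩
      exact ⟨h3 ▸ hp θ h1, θ, ⟨h1, h3⟩, h2⟩
  rw [h2, Finset.sum_comm (s := Finset.range M)]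
  refine Finset.sum_le_sum fun y _ => ?_
  -- Different `b` have different numbers at `y`, so each pair `(i, y)` is used at most once.
  rw [← Finset.sum_image (f := fun i => ‖∑ θ ∈ J i with q θ = y, z θ‖ₑ ^ 2)
    (fun a ha b hb hab => he y ha hb hab)]
  refine Finset.sum_le_sum_of_subset fun i hi => ?_
  obtain ⟨b, hb, rfl⟩ := Finset.mem_image.1 hi
  exact Finset.mem_range.2 (he' y b hb)

/-- The multiscale inequality at the scales `r ≤ R` for a family that is subordinate to the sectors
of aperture `R^{-1/2}`, where the pieces on the left side are grouped by arbitrary labels. -/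
lemma avgEnergy_labels_le {K r R : ℝ} (hr : 1 ≤ r) (hrR : r ≤ R) {par : ℝ → ℝ → ℝ}
    (hpar : IsSectorAssignment K R par) (I B : Finset ℝ) (h : ℝ → 𝓢(E3, ℂ)) (c p : ℝ → ℝ)
    (hc : ∀ θ ∈ I, c θ ∈ sectorCenters (aperture R))
    (hsupp : ∀ θ ∈ I, tsupport (𝓕 (h θ) : 𝓢(E3, ℂ)) ⊆ sector K (c θ) (aperture R))
    (hp : ∀ θ ∈ I, p θ ∈ B) (M : ℕ)
    (hM : ∀ y, ((I.filter fun θ => par (aperture r) (c θ) = y).image p).card ≤ M)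
    (hM' : ∀ b, ((I.filter fun θ => p θ = b).image fun θ => par (aperture r) (c θ)).card ≤ M) :
    ∃ J : ℕ → Finset ℝ, (∀ i, J i ⊆ I) ∧
      avgEnergy (boxMap 0 1 r) 1 (sqDensity B fun b => ∑ θ ∈ I with p θ = b, h θ) ≤
        (M ^ 3 * gridConst : ℕ) * SK K r R *
          ∑ i ∈ Finset.range M, boxSum R (fun c' => ∑ θ ∈ J i with c θ = c', h θ) par := by
  classical
  have hR : 1 ≤ R := hr.trans hrR
  obtain ⟨J, hJI, hJ⟩ := exists_regrouping I B (sectorCenters (aperture r)) p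
    (fun θ => par (aperture r) (c θ)) M hp
    (fun θ hθ => (hpar.2 _ (aperture_anti hr hrR) (aperture_le_one hr) _ (hc θ hθ)).1) hM hM'
  refine ⟨J, hJI, ?_⟩
  set g : ℕ → ℝ → 𝓢(E3, ℂ) := fun i c' => ∑ θ ∈ J i with c θ = c', h θ with hg
  -- Grouping by `c` and then by the sector assigned to `c` is grouping by the composite label.
  have hpiece : ∀ i y, sectorPiece R (g i) par (aperture r) y =
      ∑ θ ∈ J i with par (aperture r) (c θ) = y, h θ := by
    intro i y
    rw [sectorPiece, ← Finset.sum_fiberwise_of_maps_to (s := (J i).filter _)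
      (t := children R par (aperture r) y) (g := c)]
    · refine Finset.sum_congr rfl fun c' hc' => ?_
      refine Finset.sum_congr ?_ fun _ _ => rfl
      ext θ
      have := (Finset.mem_filter.1 hc').2
      simp only [Finset.mem_filter]
      constructor
      · rintro ⟨h1, h2⟩
        exact ⟨⟨h1, by rw [h2, this]⟩, h2⟩
      · rintro ⟨⟨h1, -⟩, h2⟩
        exact ⟨h1, h2⟩
    · intro θ hθ
      rw [Finset.mem_filter] at hθ
      exact Finset.mem_filter.2 ⟨hc θ (hJI i hθ.1), hθ.2⟩
  have hdens : ∀ x, sqDensity B (fun b => ∑ θ ∈ I with p θ = b, h θ) x ≤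
      M * ∑ i ∈ Finset.range M, sqDensity (sectorCenters (aperture r))
        (sectorPiece R (g i) par (aperture r)) x := by
    intro x
    have := hJ fun θ => h θ x
    simpa only [sqDensity, hpiece, sum_apply] using this
  have hSK : ∀ i, avgEnergy (boxMap 0 1 r) 1 (sqDensity (sectorCenters (aperture r))
      (sectorPiece R (g i) par (aperture r))) ≤ gridConst * (SK K r R * boxSum R (g i) par) := by
    intro i
    refine (avgEnergy_le_tsum_coverBall _ _ (by linarith)).trans ?_
    gcongr
    have hgs : ∀ c' ∈ sectorCenters (aperture R),
        tsupport (𝓕 (g i c') : 𝓢(E3, ℂ)) ⊆ sector K c' (aperture R) := by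
      intro c' _
      refine tsupport_fourier_sum_subset _ _ Metric.isClosed_cthickening fun θ hθ => ?_
      rw [Finset.mem_filter] at hθ
      rw [← hθ.2]
      exact hsupp θ (hJI i hθ.1)
    refine ballSum_le_SK_mul (f := ∑ η ∈ sectorCenters (aperture R), g i η) hR ?_ ⟨hgs, rfl⟩ hpar
    refine tsupport_fourier_sum_subset _ _ Metric.isClosed_cthickening fun c' hc' => ?_
    refine (hgs c' hc').trans ?_
    rw [sector, aperture_sq (by linarith)]
    exact Metric.cthickening_subset_of_subset _ fun x hx => hx.1
  have hmeas : ∀ i, Measurable (sqDensity (sectorCenters (aperture r))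
      (sectorPiece R (g i) par (aperture r))) := fun i => measurable_sqDensity _ _
  refine (avgEnergy_mono _ _ hdens).trans ?_
  rw [avgEnergy_const_mul _ _ (Finset.measurable_sum _ fun i _ => hmeas i)]
  -- The factor `M` in the density is squared by the energy. Separating the `M` subfamilies costs
  -- one more.
  calc _ ≤ (M : ℝ≥0∞) ^ 2 * (M * ∑ i ∈ Finset.range M,
        gridConst * (SK K r R * boxSum R (g i) par)) := by
        gcongr
        refine (avgEnergy_sum_le _ _ _ hmeas).trans ?_
        rw [Finset.card_range]
        gcongr with i
        exact hSK i
    _ = _ := by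
        rw [← Finset.mul_sum, ← Finset.mul_sum]
        push_cast
        ring

/-! ### Composition of scales -/

/-- A bound for the number of sectors of a given aperture that are near a given one. -/
def multConst : ℕ := 22 * 64 + 22

lemma card_image_le_multConst {a x : ℝ} (ha : 0 < a) (ha1 : a ≤ 1) (F : Finset ℝ) (q : ℝ → ℝ)
    (hF : ∀ θ ∈ F, q θ ∈ sectorCenters a) (hx : ∀ θ ∈ F, |q θ - x| ≤ 64 * a) :
    (F.image q).card ≤ multConst := by
  refine card_sectorCenters_le (x := x) ha ha1 64 _ (Finset.image_subset_iff.2 hF) fun c hc => ?_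
  obtain ⟨θ, hθ, rfl⟩ := Finset.mem_image.1 hc
  exact_mod_cast hx θ hθ

lemma sum_sqDensity_fiber_le (I Q : Finset ℝ) (q : ℝ → ℝ) (g : ℝ → 𝓢(E3, ℂ)) (x : E3) :
    ∑ y ∈ Q, sqDensity (I.filter fun θ => q θ = y) g x ≤ sqDensity I g x := by
  have h1 : ∀ y ∈ Q, sqDensity (I.filter fun θ => q θ = y) g x =
      ∑ θ ∈ (I.filter fun θ => q θ ∈ Q) with q θ = y, ‖g θ x‖ₑ ^ 2 := by
    intro y hy
    refine Finset.sum_congr ?_ fun _ _ => rfl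
    ext θ
    simp only [Finset.mem_filter]
    constructor
    · rintro ⟨h1, rfl⟩
      exact ⟨⟨h1, hy⟩, rfl⟩
    · rintro ⟨⟨h1, -⟩, h2⟩
      exact ⟨h1, h2⟩
  rw [Finset.sum_congr rfl h1, Finset.sum_fiberwise_of_maps_to
    (fun θ hθ => (Finset.mem_filter.1 hθ).2)]
  exact sqDensity_mono (Finset.filter_subset _ _) g x

/-- The fibres of `q` are disjoint, so superadditivity sums over arbitrarily many labels without
loss. -/
lemma sum_avgEnergy_fiber_le (Φ : E3 →ₗ[ℝ] E3) (I Q : Finset ℝ) (q : ℝ → ℝ) (g : ℝ → 𝓢(E3, ℂ)) :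
    ∑ y ∈ Q, avgEnergy Φ 1 (sqDensity (I.filter fun θ => q θ = y) g) ≤
      avgEnergy Φ 1 (sqDensity I g) :=
  (sum_avgEnergy_le _ _ _ _).trans (avgEnergy_mono _ _ (sum_sqDensity_fiber_le I Q q g))

lemma sqDensity_compLorentz {ι : Type*} (F : Finset ι) (g : ι → 𝓢(E3, ℂ)) (η₀ t : ℝ) (ht : t ≠ 0)
    (x : E3) : sqDensity F (fun i => compLorentz η₀ t ht (g i)) x =
      sqDensity F g (lorentzT η₀ t ht x) := rfl

/-- The first step: passage from the scales `r₁, r₃` to `r₁, r₂` after a rescaling by two, which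
makes room for the sectors at the scale `r₃` inside those at the scale `r₂`. -/
lemma ballSum_le_sum_boxSum {K r₁ r₂ r₃ : ℝ} (hK : 10 ≤ K) (h1 : 1 ≤ r₁) (h12 : r₁ < r₂)
    (h23 : r₂ ≤ r₃) {par par₂ : ℝ → ℝ → ℝ} (hpar : IsSectorAssignment K r₃ par)
    (hpar₂ : IsSectorAssignment K r₂ par₂) (g : ℝ → 𝓢(E3, ℂ))
    (hg : ∀ θ ∈ sectorCenters (aperture r₃),
      tsupport (𝓕 (g θ) : 𝓢(E3, ℂ)) ⊆ sector K θ (aperture r₃)) :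
    ∃ (J : ℕ → Finset ℝ) (c : ℝ → ℝ), (∀ i, J i ⊆ sectorCenters (aperture r₃)) ∧
      (∀ θ ∈ sectorCenters (aperture r₃), c θ ∈ sectorCenters (aperture r₂) ∧
        |θ / 2 - c θ| ≤ aperture r₂) ∧
      ballSum r₁ r₃ g par ≤ (gridConst * cmpConst 4 * (multConst ^ 3 * gridConst) : ℕ) *
        SK K r₁ r₂ * ∑ i ∈ Finset.range multConst, (absDet (lorentzT 0 2 two_ne_zero).toLinearEquiv *
          boxSum r₂ (fun c' => ∑ θ ∈ J i with c θ = c', compLorentz 0 2 two_ne_zero (g θ)) par₂) := by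
  have hr2 : 1 ≤ r₂ := h1.trans h12.le
  have hr3 : 1 ≤ r₃ := hr2.trans h23
  have ha1 := aperture_pos h1
  have ha2 := aperture_pos hr2
  have ha3 := aperture_pos hr3
  have ha11 := aperture_le_one h1
  have ha21 := aperture_le_one hr2
  have ha31 := aperture_le_one hr3
  have ha12 := aperture_anti h1 h12.le
  have ha23 := aperture_anti hr2 h23
  have hθ1 : ∀ θ ∈ sectorCenters (aperture r₃), |θ| ≤ 1 := fun θ hθ =>
    abs_le_one_of_mem_sectorCenters ha3 ha31 hθ
  have hex : ∀ θ, ∃ c, θ ∈ sectorCenters (aperture r₃) → c ∈ sectorCenters (aperture r₂) ∧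
      |θ / 2 - c| ≤ aperture r₂ ∧
      ∀ β, |β| ≤ 1 → |β - θ / 2| ≤ aperture r₂ / 2 → |β - c| ≤ aperture r₂ := by
    intro θ
    by_cases hθ : θ ∈ sectorCenters (aperture r₃)
    · have := hθ1 θ hθ
      obtain ⟨c, hc⟩ := exists_sectorCenter ha2 ha21 (α := θ / 2)
        (by rw [abs_div, abs_two]; linarith)
      exact ⟨c, fun _ => hc⟩
    · exact ⟨0, fun h => absurd h hθ⟩
  choose c hc using hex
  have hsupp : ∀ θ ∈ sectorCenters (aperture r₃),
      tsupport (𝓕 (compLorentz 0 2 two_ne_zero (g θ)) : 𝓢(E3, ℂ)) ⊆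
        sector K (c θ) (aperture r₂) := by
    intro θ hθ
    -- The dilation halves the ratio interval of `θ`, which then fits into the sector at `c θ`.
    -- Being a contraction, it does not increase the thickness.
    refine tsupport_compLorentz_subset (Λ := 1) hK two_ne_zero one_pos ?_ ?_ ?_ (hg θ hθ)
    · intro y hy hy'
      have e : |(y - 0) / 2| ≤ 1 := by
        rw [sub_zero, abs_div, abs_two]; linarith
      refine ⟨e, (hc θ hθ).2.2 _ e ?_⟩
      rw [show (y - 0) / 2 - θ / 2 = (y - θ) / 2 by ring, abs_div, abs_two]
      linarith
    · intro w
      refine (lorentz_norm_le two_pos (Or.inr ⟨rfl, rfl⟩) w).trans (le_of_eq ?_)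
      norm_num
    · rw [one_mul]
      exact pow_le_pow_left₀ ha3.le ha23 2
  have hp : ∀ θ ∈ sectorCenters (aperture r₃),
      par (aperture r₁) θ ∈ sectorCenters (aperture r₁) ∧
        |θ - par (aperture r₁) θ| ≤ 10 * aperture r₁ := fun θ hθ =>
    ⟨(hpar.2 _ (ha23.trans ha12) ha11 θ hθ).1,
      abs_sub_le_of_assignment hK hr3 hpar (ha23.trans ha12) ha11 hθ⟩
  have hq : ∀ θ ∈ sectorCenters (aperture r₃),
      par₂ (aperture r₁) (c θ) ∈ sectorCenters (aperture r₁) ∧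
        |c θ - par₂ (aperture r₁) (c θ)| ≤ 10 * aperture r₁ := fun θ hθ =>
    ⟨(hpar₂.2 _ ha12 ha11 _ (hc θ hθ).1).1,
      abs_sub_le_of_assignment hK hr2 hpar₂ ha12 ha11 (hc θ hθ).1⟩
  obtain ⟨J, hJ, hmain⟩ := avgEnergy_labels_le h1 h12.le hpar₂ (sectorCenters (aperture r₃))
    (sectorCenters (aperture r₁)) (fun θ => compLorentz 0 2 two_ne_zero (g θ)) c
    (par (aperture r₁)) (fun θ hθ => (hc θ hθ).1) hsupp (fun θ hθ => (hp θ hθ).1) multConst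
    (by
      intro y
      refine card_image_le_multConst (x := 2 * y) ha1 ha11 _ _
        (fun θ hθ => (hp θ (Finset.mem_filter.1 hθ).1).1) fun θ hθ => ?_
      obtain ⟨hθI, rfl⟩ := Finset.mem_filter.1 hθ
      have b1 := (hp θ hθI).2
      have b2 := (hq θ hθI).2
      have b3 := (hc θ hθI).2.1
      rw [abs_le] at b1 b2 b3 ⊢
      constructor <;> linarith)
    (by
      intro b
      refine card_image_le_multConst (x := b / 2) ha1 ha11 _ _
        (fun θ hθ => (hq θ (Finset.mem_filter.1 hθ).1).1) fun θ hθ => ?_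
      obtain ⟨hθI, rfl⟩ := Finset.mem_filter.1 hθ
      have b1 := (hp θ hθI).2
      have b2 := (hq θ hθI).2
      have b3 := (hc θ hθI).2.1
      rw [abs_le] at b1 b2 b3 ⊢
      constructor <;> linarith)
  refine ⟨J, c, hJ, fun θ hθ => ⟨(hc θ hθ).1, (hc θ hθ).2.1⟩, ?_⟩
  set S := sqDensity (sectorCenters (aperture r₁)) (sectorPiece r₃ g par (aperture r₁)) with hS
  have e1 : ballSum r₁ r₃ g par ≤ gridConst * avgEnergy (boxMap 0 1 r₁) 1 S :=
    tsum_coverBall_le _ _ (by linarith)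
  -- The ball of radius `r₁` corresponds under the dilation to the box of aperture `2` and scale
  -- `r₁/4`, which is comparable to a ball of radius `r₁`.
  have e2 : avgEnergy (boxMap 0 1 r₁) 1 S ≤
      cmpConst 4 * avgEnergy (boxMap 0 (2 * 1) (r₁ / 2 ^ 2)) 1 S :=
    avgEnergy_boxMap_le 4 (by norm_num) one_pos (by norm_num) (by linarith) (by linarith)
      (by norm_num) (by norm_num) (by push_cast; linarith) (by push_cast; linarith) (by norm_num) S
  have e3 := avgEnergy_lorentz 0 0 1 r₁ two_ne_zero S
  rw [sub_zero, zero_div] at e3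
  have e4 : (fun x => S (lorentzT 0 2 two_ne_zero x)) =
      sqDensity (sectorCenters (aperture r₁)) fun b =>
        ∑ θ ∈ sectorCenters (aperture r₃) with par (aperture r₁) θ = b,
          compLorentz 0 2 two_ne_zero (g θ) := by
    funext x
    rw [hS, ← sqDensity_compLorentz]
    refine Finset.sum_congr rfl fun b _ => ?_
    simp only [sectorPiece, children, map_sum]
  rw [e4] at e3
  set d := absDet (lorentzT 0 2 two_ne_zero).toLinearEquiv with hd
  calc ballSum r₁ r₃ g par ≤ gridConst * (cmpConst 4 * (d * avgEnergy (boxMap 0 1 r₁) 1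
        (sqDensity (sectorCenters (aperture r₁)) fun b =>
          ∑ θ ∈ sectorCenters (aperture r₃) with par (aperture r₁) θ = b,
            compLorentz 0 2 two_ne_zero (g θ)))) := by
        rw [e3]
        exact e1.trans (by gcongr)
    _ ≤ gridConst * (cmpConst 4 * (d * ((multConst ^ 3 * gridConst : ℕ) * SK K r₁ r₂ *
          ∑ i ∈ Finset.range multConst, boxSum r₂ (fun c' => ∑ θ ∈ J i with c θ = c',
            compLorentz 0 2 two_ne_zero (g θ)) par₂))) := by gcongr
    _ = _ := by
        rw [← Finset.mul_sum]
        push_cast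
        ring

/-- The parameters of the Lorentz rescaling that is used for a sector of aperture `s`. -/
lemma exists_rescaling {r s η : ℝ} (hs : s ∈ dyadicScales r) (hη : |η| ≤ 1) :
    ∃ σ ∈ dyadicScales r, ∃ η₀ : ℝ, ((2 * σ ≤ 1 ∧ |η₀| ≤ 1) ∨ (2 * σ = 2 ∧ η₀ = 0)) ∧ s ≤ σ ∧
      σ ≤ 8 * s ∧ |η₀ - η| ≤ 16 * (2 * σ) ∧
      ∀ y, |y| ≤ 1 → |y - η| ≤ 12 * s → |y - η₀| ≤ 2 * σ := by
  have hpos := mem_dyadicScales_pos hs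
  have hle := mem_dyadicScales_le_one hs
  obtain ⟨⟨k, hk⟩, hs2⟩ := hs
  -- For `k ≥ 4`, `σ = 8s` is dyadic and `2σ = 16s ≤ 1` leaves room for the radius `12s`. For larger
  -- `s` the sector is already comparable to the whole cone, and the plain dilation `σ = 1`
  -- suffices.
  rcases lt_or_ge k 4 with h4 | h4
  · have h8 : 1 / 8 ≤ s := by
      rw [hk]
      calc (1 / 8 : ℝ) = (1 / 2) ^ 3 := by norm_num
        _ ≤ (1 / 2) ^ k := pow_le_pow_of_le_one (by norm_num) (by norm_num) (by omega)
    refine ⟨1, ⟨⟨0, by simp⟩, hs2.trans hle⟩, 0, Or.inr ⟨by norm_num, rfl⟩, hle, by linarith, ?_, ?_⟩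
    · rw [zero_sub, abs_neg]; linarith
    · intro y hy _
      rw [sub_zero]; linarith
  · obtain ⟨m, rfl⟩ := Nat.exists_eq_add_of_le h4
    have e : 8 * s = (1 / 2) ^ (m + 1) := by rw [hk, pow_add, pow_succ]; ring
    refine ⟨8 * s, ⟨⟨m + 1, e⟩, by linarith⟩, η, Or.inl ⟨?_, hη⟩, by linarith, le_rfl, ?_, ?_⟩
    · have : (1 / 2 : ℝ) ^ m ≤ 1 := pow_le_one₀ (by norm_num) (by norm_num)
      rw [e, pow_succ]; linarith
    · rw [sub_self, abs_zero]; linarith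
    · intro y _ hy
      linarith

/-- Transport of the energy of a rescaled family to the original scales: the boxes at the scale
`σ² r₃` in the rescaled space are comparable with boxes at the scale `r₃`. -/
lemma avgEnergy_rescaled_le {K r₃ σ η₀ : ℝ} (hK : 10 ≤ K) (h3 : 1 ≤ r₃) (hσ : 0 < σ)
    {par : ℝ → ℝ → ℝ} (hpar : IsSectorAssignment K r₃ par) (g : ℝ → 𝓢(E3, ℂ)) {s η : ℝ}
    (hs : 0 < s) (hσs : aperture r₃ ≤ σ * s) (hσs1 : σ * s ≤ 1) (J : Finset ℝ)
    (hJ : J ⊆ sectorCenters (aperture r₃))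
    (hnear : ∀ θ ∈ J, |θ - 2 * (η₀ + 2 * σ * η)| ≤ 44 * (σ * s)) (hσ2 : 2 * σ ≠ 0) :
    absDet (lorentzT 0 2 two_ne_zero).toLinearEquiv *
      (absDet (lorentzT η₀ (2 * σ) hσ2).toLinearEquiv *
        avgEnergy (boxMap η s (σ ^ 2 * r₃)) 1 (sqDensity J fun θ =>
          compLorentz η₀ (2 * σ) hσ2 (compLorentz 0 2 two_ne_zero (g θ)))) ≤
      (multConst * cmpConst 64 : ℕ) * ∑ τ ∈ sectorCenters (σ * s),
        avgEnergy (boxMap τ (σ * s) r₃) 1 (sqDensity (J.filter fun θ => par (σ * s) θ = τ) g) := by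
  classical
  have hσs0 : 0 < σ * s := by positivity
  have hr3 : 0 < r₃ := by linarith
  -- Undoing both rescalings takes `(s, σ²r₃)` to `(2σs, r₃/4)` and then to `(4σs, r₃/16)`,
  -- comparable to `(σs, r₃)`. The centre becomes `2(η₀ + 2ση)`.
  have e1 := avgEnergy_lorentz (η₀ + 2 * σ * η) η₀ s (σ ^ 2 * r₃) hσ2
    (sqDensity J fun θ => compLorentz 0 2 two_ne_zero (g θ))
  rw [add_sub_cancel_left, mul_div_cancel_left₀ η hσ2] at e1
  have e2 := avgEnergy_lorentz (2 * (η₀ + 2 * σ * η)) 0 (2 * σ * s) (σ ^ 2 * r₃ / (2 * σ) ^ 2)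
    two_ne_zero (sqDensity J g)
  rw [sub_zero, mul_div_cancel_left₀ _ (two_ne_zero)] at e2
  have e3 : σ ^ 2 * r₃ / (2 * σ) ^ 2 / 2 ^ 2 = r₃ / 16 := by field_simp; norm_num
  rw [e3] at e2
  calc _ = avgEnergy (boxMap (2 * (η₀ + 2 * σ * η)) (2 * (2 * σ * s)) (r₃ / 16)) 1
        (sqDensity J g) := by
        rw [← e2]
        exact congrArg _ e1
    _ ≤ _ := ?_
  -- All labels lie within `(44 + 10)σs` of the transported centre, so there are boundedly many and
  -- their boxes are comparable to the transported one.
  set T := J.image (par (σ * s)) with hT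
  have hpn : ∀ θ ∈ J, par (σ * s) θ ∈ sectorCenters (σ * s) ∧
      |par (σ * s) θ - 2 * (η₀ + 2 * σ * η)| ≤ 64 * (σ * s) := by
    intro θ hθ
    refine ⟨(hpar.2 _ hσs hσs1 θ (hJ hθ)).1, ?_⟩
    have b1 := abs_sub_le_of_assignment hK h3 hpar hσs hσs1 (hJ hθ)
    have b2 := hnear θ hθ
    rw [abs_le] at b1 b2 ⊢
    constructor <;> linarith
  have hTcard : T.card ≤ multConst := card_image_le_multConst hσs0 hσs1 _ _
    (fun θ hθ => (hpn θ hθ).1) fun θ hθ => (hpn θ hθ).2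
  have hsplit : sqDensity J g =
      fun x => ∑ τ ∈ T, sqDensity (J.filter fun θ => par (σ * s) θ = τ) g x := by
    funext x
    exact (Finset.sum_fiberwise_of_maps_to (fun θ hθ => Finset.mem_image_of_mem _ hθ) _).symm
  rw [hsplit]
  calc _ ≤ (T.card : ℝ≥0∞) * ∑ τ ∈ T,
        avgEnergy (boxMap (2 * (η₀ + 2 * σ * η)) (2 * (2 * σ * s)) (r₃ / 16)) 1
          (sqDensity (J.filter fun θ => par (σ * s) θ = τ) g) :=
        avgEnergy_sum_le _ _ _ fun τ => measurable_sqDensity _ _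
    _ ≤ (multConst : ℝ≥0∞) * ∑ τ ∈ T, cmpConst 64 *
        avgEnergy (boxMap τ (σ * s) r₃) 1
          (sqDensity (J.filter fun θ => par (σ * s) θ = τ) g) := by
        gcongr with τ hτ
        obtain ⟨θ, hθ, rfl⟩ := Finset.mem_image.1 hτ
        refine avgEnergy_boxMap_le 64 (by norm_num) (by positivity) hσs0 (by positivity) hr3
          ?_ ?_ ?_ ?_ ?_ _
        · push_cast; linarith
        · push_cast; linarith
        · push_cast; linarith
        · push_cast; linarith
        · exact_mod_cast (hpn θ hθ).2
    _ ≤ _ := by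
        rw [← Finset.mul_sum, ← mul_assoc, Nat.cast_mul]
        gcongr
        exact Finset.image_subset_iff.2 fun θ hθ => (hpn θ hθ).1

/-- The constant that is lost in the treatment of the pieces inside one sector. -/
def sectorConst : ℕ := cmpConst 16 * (multConst ^ 3 * gridConst) *
  (multConst * (gridConst * multConst ^ 2 * (multConst * cmpConst 64)))

/-- The second step: the pieces inside one sector of aperture `s` are treated by a Lorentz rescaling
and the multiscale inequality at the scales `σ² r₂, σ² r₃`. -/
lemma avgEnergy_sector_le {K r₂ r₃ : ℝ} (hK : 10 ≤ K) (h2 : 1 ≤ r₂) (h23 : r₂ ≤ r₃)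
    {par : ℝ → ℝ → ℝ} (hpar : IsSectorAssignment K r₃ par) (g : ℝ → 𝓢(E3, ℂ))
    (hg : ∀ θ ∈ sectorCenters (aperture r₃),
      tsupport (𝓕 (g θ) : 𝓢(E3, ℂ)) ⊆ sector K θ (aperture r₃))
    {s η : ℝ} (hs : s ∈ dyadicScales r₂) (hη : |η| ≤ 1) (J : Finset ℝ)
    (hJ : J ⊆ sectorCenters (aperture r₃)) (c : ℝ → ℝ)
    (hc : ∀ θ ∈ J, c θ ∈ sectorCenters (aperture r₂) ∧ |θ / 2 - c θ| ≤ aperture r₂ ∧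
      |c θ - η| ≤ 10 * s) :
    absDet (lorentzT 0 2 two_ne_zero).toLinearEquiv *
      avgEnergy (boxMap η s r₂) 1 (sqDensity (sectorCenters (aperture r₂)) fun c' =>
        ∑ θ ∈ J with c θ = c', compLorentz 0 2 two_ne_zero (g θ)) ≤
      sectorConst * (⨆ s ∈ dyadicScales r₂, SK K (s ^ 2 * r₂) (s ^ 2 * r₃)) *
        ∑' t : dyadicScales r₃, ∑ τ ∈ sectorCenters (t : ℝ),
          avgEnergy (boxMap τ t r₃) 1 (sqDensity (J.filter fun θ => par t θ = τ) g) := by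
  have h3 : 1 ≤ r₃ := h2.trans h23
  have ha2 := aperture_pos h2
  have ha3 := aperture_pos h3
  have ha31 := aperture_le_one h3
  have ha23 := aperture_anti h2 h23
  have hs0 := mem_dyadicScales_pos hs
  have has : aperture r₂ ≤ s := hs.2
  obtain ⟨σ, hσ, η₀, hcase, hsσ, hσs, hηη₀, hy⟩ := exists_rescaling hs hη
  have hσ0 := mem_dyadicScales_pos hσ
  have hσ2 : 2 * σ ≠ 0 := by positivity
  have hR2 : 1 ≤ σ ^ 2 * r₂ := one_le_sq_mul h2 hσ.2
  have hR23 : σ ^ 2 * r₂ ≤ σ ^ 2 * r₃ := by gcongr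
  have hR3 : 1 ≤ σ ^ 2 * r₃ := hR2.trans hR23
  have eR2 : aperture (σ ^ 2 * r₂) = aperture r₂ / σ := aperture_sq_mul hσ0 (by linarith)
  have eR3 : aperture (σ ^ 2 * r₃) = aperture r₃ / σ := aperture_sq_mul hσ0 (by linarith)
  have hA2 := aperture_pos hR2
  have hA3 := aperture_pos hR3
  have hA21 := aperture_le_one hR2
  have hA31 := aperture_le_one hR3
  have hA23 := aperture_anti hR2 hR23
  have mR2 : aperture r₂ = σ * aperture (σ ^ 2 * r₂) := by rw [eR2]; field_simp
  have mR3 : aperture r₃ = σ * aperture (σ ^ 2 * r₃) := by rw [eR3]; field_simp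
  -- The centre of `θ` in the ratio coordinate after both rescalings.
  set α : ℝ → ℝ := fun θ => (θ / 2 - η₀) / (2 * σ) with hα
  have hθ1 : ∀ θ ∈ J, |θ / 2 - η₀| ≤ 2 * σ ∧ |θ / 2| ≤ 1 ∧ |θ / 2 - η| ≤ 11 * s := by
    intro θ hθ
    have b0 := abs_le_one_of_mem_sectorCenters ha3 ha31 (hJ hθ)
    have b1 : |θ / 2| ≤ 1 := by rw [abs_div, abs_two]; linarith
    have b2 := (hc θ hθ).2.1
    have b3 := (hc θ hθ).2.2
    have b4 : |θ / 2 - η| ≤ 11 * s := by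
      rw [abs_le] at b2 b3 ⊢
      constructor <;> linarith
    exact ⟨hy _ b1 (by linarith), b1, b4⟩
  have hex : ∀ θ, ∃ c₂, θ ∈ J → c₂ ∈ sectorCenters (aperture (σ ^ 2 * r₃)) ∧
      |α θ - c₂| ≤ aperture (σ ^ 2 * r₃) ∧ ∀ β, |β| ≤ 1 →
        |β - α θ| ≤ aperture (σ ^ 2 * r₃) / 2 → |β - c₂| ≤ aperture (σ ^ 2 * r₃) := by
    intro θ
    by_cases hθ : θ ∈ J
    · obtain ⟨c₂, hc₂⟩ := exists_sectorCenter hA3 hA31 (α := α θ) (by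
        rw [hα]
        simp only
        rw [abs_div, abs_of_pos (by positivity : 0 < 2 * σ), div_le_one (by positivity)]
        exact (hθ1 θ hθ).1)
      exact ⟨c₂, fun _ => hc₂⟩
    · exact ⟨0, fun h => absurd h hθ⟩
  choose c₂ hc₂ using hex
  set h : ℝ → 𝓢(E3, ℂ) := fun θ => compLorentz 0 2 two_ne_zero (g θ) with hh
  set h' : ℝ → 𝓢(E3, ℂ) := fun θ => compLorentz η₀ (2 * σ) hσ2 (h θ) with hh'
  have hsupp : ∀ θ ∈ J, tsupport (𝓕 (h' θ) : 𝓢(E3, ℂ)) ⊆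
      sector K (c₂ θ) (aperture (σ ^ 2 * r₃)) := by
    intro θ hθ
    have hsupp1 : tsupport (𝓕 (h θ) : 𝓢(E3, ℂ)) ⊆ sector K (θ / 2) (aperture r₃) := by
      refine tsupport_compLorentz_subset (Λ := 1) hK two_ne_zero one_pos ?_ ?_ ?_ (hg θ (hJ hθ))
      · intro y hy hy'
        rw [sub_zero, show y / 2 - θ / 2 = (y - θ) / 2 by ring, abs_div, abs_div, abs_two]
        constructor <;> linarith
      · intro w
        refine (lorentz_norm_le two_pos (Or.inr ⟨rfl, rfl⟩) w).trans (le_of_eq ?_)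
        norm_num
      · rw [one_mul]
    -- With `t = 2σ` the ratio interval shrinks to half the aperture of scale `σ²r₃`, which provides
    -- the room, while the thickness bound becomes exactly the square of that aperture.
    refine tsupport_compLorentz_subset (Λ := 4 / (2 * σ) ^ 2) hK hσ2 (by positivity) ?_
      (lorentz_norm_le (by positivity) hcase) ?_ hsupp1
    · intro y hy1 hy2
      -- The radius `12s` is `10s` from the assignment, plus the apertures of scales `r₂` and `r₃`,
      -- each at most `s`.
      have b1 : |y - η₀| ≤ 2 * σ := by
        refine hy y hy1 ?_
        have := (hθ1 θ hθ).2.2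
        rw [abs_le] at this hy2 ⊢
        constructor <;> linarith
      have b2 : |(y - η₀) / (2 * σ)| ≤ 1 := by
        rw [abs_div, abs_of_pos (by positivity : 0 < 2 * σ), div_le_one (by positivity)]
        exact b1
      refine ⟨b2, (hc₂ θ hθ).2.2 _ b2 ?_⟩
      rw [hα, show (y - η₀) / (2 * σ) - (θ / 2 - η₀) / (2 * σ) = (y - θ / 2) / (2 * σ) by ring,
        abs_div, abs_of_pos (by positivity : 0 < 2 * σ), div_le_iff₀ (by positivity)]
      linarith
    · rw [eR3, div_pow]
      refine le_of_eq ?_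
      field_simp
      norm_num
  obtain ⟨par₃, hpar₃⟩ := exists_isSectorAssignment hK hR3
  have hq : ∀ θ ∈ J, ∀ s', aperture (σ ^ 2 * r₃) ≤ s' → s' ≤ 1 →
      par₃ s' (c₂ θ) ∈ sectorCenters s' ∧ |c₂ θ - par₃ s' (c₂ θ)| ≤ 10 * s' :=
    fun θ hθ s' b1 b2 => ⟨(hpar₃.2 _ b1 b2 _ (hc₂ θ hθ).1).1,
      abs_sub_le_of_assignment hK hR3 hpar₃ b1 b2 (hc₂ θ hθ).1⟩
  have hαe : ∀ θ, θ / 2 = η₀ + 2 * (σ * α θ) := by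
    intro θ; rw [hα]; field_simp; ring
  obtain ⟨J', hJ', hmain⟩ := avgEnergy_labels_le hR2 hR23 hpar₃ J (sectorCenters (aperture r₂)) h'
    c₂ c (fun θ hθ => (hc₂ θ hθ).1) hsupp (fun θ hθ => (hc θ hθ).1) multConst
    (by
      intro y
      refine card_image_le_multConst (x := η₀ + 2 * (σ * y)) ha2 (aperture_le_one h2) _ _
        (fun θ hθ => (hc θ (Finset.mem_filter.1 hθ).1).1) fun θ hθ => ?_
      obtain ⟨hθJ, rfl⟩ := Finset.mem_filter.1 hθ
      have b1 := (hq θ hθJ _ hA23 hA21).2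
      have b2 := (hc₂ θ hθJ).2.1
      have b3 := (hc θ hθJ).2.1
      rw [hαe] at b3
      set y := par₃ (aperture (σ ^ 2 * r₂)) (c₂ θ)
      have b4 : |σ * (α θ - y)| ≤ 11 * aperture r₂ := by
        rw [abs_mul, abs_of_pos hσ0, mR2, mul_left_comm]
        gcongr
        rw [abs_le] at b1 b2 ⊢
        constructor <;> linarith
      rw [abs_le] at b3 b4 ⊢
      constructor <;> linarith)
    (by
      intro b
      refine card_image_le_multConst (x := (b - η₀) / (2 * σ)) hA2 hA21 _ _
        (fun θ hθ => (hq θ (Finset.mem_filter.1 hθ).1 _ hA23 hA21).1) fun θ hθ => ?_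
      obtain ⟨hθJ, rfl⟩ := Finset.mem_filter.1 hθ
      have b1 := (hq θ hθJ _ hA23 hA21).2
      have b2 := (hc₂ θ hθJ).2.1
      have b3 := (hc θ hθJ).2.1
      have b4 : |α θ - (c θ - η₀) / (2 * σ)| ≤ aperture (σ ^ 2 * r₂) := by
        rw [hα, show (θ / 2 - η₀) / (2 * σ) - (c θ - η₀) / (2 * σ) = (θ / 2 - c θ) / (2 * σ) by ring,
          abs_div, abs_of_pos (by positivity : 0 < 2 * σ), div_le_iff₀ (by positivity)]
        linarith
      rw [abs_le] at b1 b2 b4 ⊢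
      constructor <;> linarith)
  set S := sqDensity (sectorCenters (aperture r₂)) fun c' => ∑ θ ∈ J with c θ = c', h θ with hS
  set d₁ := absDet (lorentzT 0 2 two_ne_zero).toLinearEquiv with hd₁
  set d₂ := absDet (lorentzT η₀ (2 * σ) hσ2).toLinearEquiv with hd₂
  have e1 : avgEnergy (boxMap η s r₂) 1 S ≤ cmpConst 16 *
      avgEnergy (boxMap η₀ (2 * σ * 1) (σ ^ 2 * r₂ / (2 * σ) ^ 2)) 1 S := by
    rw [show σ ^ 2 * r₂ / (2 * σ) ^ 2 = r₂ / 4 by field_simp; norm_num]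
    refine avgEnergy_boxMap_le 16 (by norm_num) hs0 (by positivity) (by linarith) (by linarith)
      ?_ ?_ ?_ ?_ ?_ _
    · push_cast; linarith
    · push_cast; linarith
    · push_cast; linarith
    · push_cast; linarith
    · push_cast; linarith
  have e2 := avgEnergy_lorentz η₀ η₀ 1 (σ ^ 2 * r₂) hσ2 S
  rw [sub_self, zero_div] at e2
  have e3 : (fun x => S (lorentzT η₀ (2 * σ) hσ2 x)) =
      sqDensity (sectorCenters (aperture r₂)) fun c' => ∑ θ ∈ J with c θ = c', h' θ := by
    funext x
    rw [hS, ← sqDensity_compLorentz]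
    refine Finset.sum_congr rfl fun b _ => ?_
    simp only [map_sum, hh']
  rw [e3] at e2
  set E : ℝ → ℝ≥0∞ := fun t => ∑ τ ∈ sectorCenters t,
    avgEnergy (boxMap τ t r₃) 1 (sqDensity (J.filter fun θ => par t θ = τ) g) with hE
  -- Here it matters that `σ` is dyadic: the scales of the rescaled problem are then scales of the
  -- original one.
  have hscale : ∀ s' ∈ dyadicScales (σ ^ 2 * r₃), σ * s' ∈ dyadicScales r₃ := by
    rintro s' ⟨⟨k, hk⟩, hs'⟩
    obtain ⟨⟨l, hl⟩, -⟩ := hσ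
    refine ⟨⟨l + k, by rw [hk, hl, pow_add]⟩, ?_⟩
    rw [mR3]
    gcongr
  have hbox : ∀ i, d₁ * (d₂ * boxSum (σ ^ 2 * r₃)
      (fun c' => ∑ θ ∈ J' i with c₂ θ = c', h' θ) par₃) ≤
      (gridConst * multConst ^ 2 * (multConst * cmpConst 64) : ℕ) *
        ∑' t : dyadicScales r₃, E t := by
    intro i
    set G : ℝ → 𝓢(E3, ℂ) := fun c' => ∑ θ ∈ J' i with c₂ θ = c', h' θ with hG
    have hterm : ∀ s' ∈ dyadicScales (σ ^ 2 * r₃), d₁ * (d₂ * ∑ η' ∈ sectorCenters s',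
        ∑' k, normalizedL2 (tileU η' s' (σ ^ 2 * r₃) k)
          (boxSquareFn (σ ^ 2 * r₃) G par₃ s' η')) ≤
        (gridConst * multConst ^ 2 * (multConst * cmpConst 64) : ℕ) * E (σ * s') := by
      intro s' hs'
      have hs'0 := mem_dyadicScales_pos hs'
      have hs'1 := mem_dyadicScales_le_one hs'
      have hσs' := hscale s' hs'
      have hone : ∀ η' ∈ sectorCenters s', d₁ * (d₂ * ∑' k, normalizedL2
          (tileU η' s' (σ ^ 2 * r₃) k) (boxSquareFn (σ ^ 2 * r₃) G par₃ s' η')) ≤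
          (gridConst * multConst ^ 2 * (multConst * cmpConst 64) : ℕ) *
            ∑ τ ∈ sectorCenters (σ * s'), avgEnergy (boxMap τ (σ * s') r₃) 1
              (sqDensity ((J.filter fun θ => par (σ * s') θ = τ).filter
                fun θ => par₃ s' (c₂ θ) = η') g) := by
        intro η' hη'
        have f1 := tsum_tileU_le (children (σ ^ 2 * r₃) par₃ s' η') G hs'0 hs'1
          (by linarith : 0 < σ ^ 2 * r₃) (abs_le_one_of_mem_sectorCenters hs'0 hs'1 hη')
        -- Boundedly many `θ` share a centre `c₂ θ`. Cauchy–Schwarz undoes this grouping, so that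
        -- only the individual `f_θ` remain.
        have f2 : ∀ x, sqDensity (children (σ ^ 2 * r₃) par₃ s' η') G x ≤
            multConst * sqDensity (J.filter fun θ => par₃ s' (c₂ θ) = η') h' x := by
          intro x
          have f3 : ∀ c' ∈ children (σ ^ 2 * r₃) par₃ s' η', ‖G c' x‖ₑ ^ 2 ≤
              multConst * ∑ θ ∈ (J.filter fun θ => par₃ s' (c₂ θ) = η') with c₂ θ = c',
                ‖h' θ x‖ₑ ^ 2 := by
            intro c' hc'
            rw [hG, sum_apply]
            refine (enorm_sum_sq_le _ _).trans ?_
            gcongr ?_ * ?_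
            · have : ((J' i).filter fun θ => c₂ θ = c').card ≤ multConst := by
                rw [← Finset.image_id (s := (J' i).filter fun θ => c₂ θ = c')]
                refine card_image_le_multConst (x := 2 * (η₀ + 2 * (σ * c'))) ha3 ha31 _ _
                  (fun θ hθ => hJ (hJ' i (Finset.mem_filter.1 hθ).1)) fun θ hθ => ?_
                obtain ⟨hθJ, rfl⟩ := Finset.mem_filter.1 hθ
                have b2 := (hc₂ θ (hJ' i hθJ)).2.1
                have b3 : |σ * (α θ - c₂ θ)| ≤ aperture r₃ := by
                  rw [abs_mul, abs_of_pos hσ0, mR3]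
                  gcongr
                have b4 := hαe θ
                rw [abs_le] at b3
                rw [id, abs_le]
                constructor <;> linarith
              exact_mod_cast this
            · refine Finset.sum_le_sum_of_subset fun θ hθ => ?_
              obtain ⟨hθJ, rfl⟩ := Finset.mem_filter.1 hθ
              have := (Finset.mem_filter.1 hc').2
              exact Finset.mem_filter.2 ⟨Finset.mem_filter.2 ⟨hJ' i hθJ, this⟩, rfl⟩
          refine (Finset.sum_le_sum f3).trans ?_
          rw [← Finset.mul_sum]
          gcongr
          rw [Finset.sum_fiberwise_of_maps_to]
          · rfl
          · intro θ hθ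
            obtain ⟨hθJ, hθ2⟩ := Finset.mem_filter.1 hθ
            exact Finset.mem_filter.2 ⟨(hc₂ θ hθJ).1, hθ2⟩
        have f4 := (f1.trans (mul_le_mul' le_rfl (avgEnergy_mono _ _ f2))).trans_eq
          (by rw [avgEnergy_const_mul _ _ (measurable_sqDensity _ _)])
        have f5 := avgEnergy_rescaled_le (η₀ := η₀) (η := η') (s := s') hK h3 hσ0 hpar g hs'0
          hσs'.2 (mem_dyadicScales_le_one hσs') (J.filter fun θ => par₃ s' (c₂ θ) = η')
          ((Finset.filter_subset _ _).trans hJ) (by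
            intro θ hθ
            obtain ⟨hθJ, rfl⟩ := Finset.mem_filter.1 hθ
            have b1 := (hq θ hθJ s' hs'.2 hs'1).2
            have b2 := (hc₂ θ hθJ).2.1
            have b3 : aperture (σ ^ 2 * r₃) ≤ s' := hs'.2
            set y := par₃ s' (c₂ θ)
            have b4 : |σ * (α θ - y)| ≤ 11 * (σ * s') := by
              rw [abs_mul, abs_of_pos hσ0, mul_left_comm]
              gcongr
              rw [abs_le] at b1 b2 ⊢
              constructor <;> linarith
            have b5 := hαe θ
            rw [abs_le] at b4 ⊢
            constructor <;> linarith) hσ2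
        calc _ ≤ d₁ * (d₂ * (gridConst * ((multConst : ℝ≥0∞) ^ 2 * avgEnergy
              (boxMap η' s' (σ ^ 2 * r₃)) 1
              (sqDensity (J.filter fun θ => par₃ s' (c₂ θ) = η') h')))) := by
              gcongr
              exact f4
          _ = gridConst * (multConst : ℝ≥0∞) ^ 2 * (d₁ * (d₂ * avgEnergy
              (boxMap η' s' (σ ^ 2 * r₃)) 1
              (sqDensity (J.filter fun θ => par₃ s' (c₂ θ) = η') h'))) := by ring
          _ ≤ gridConst * (multConst : ℝ≥0∞) ^ 2 * _ := mul_le_mul' le_rfl f5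
          _ = _ := by
              rw [← mul_assoc]
              simp_rw [Finset.filter_comm (p := fun θ => par₃ s' (c₂ θ) = η')]
              push_cast
              rfl
      rw [Finset.mul_sum, Finset.mul_sum]
      refine (Finset.sum_le_sum hone).trans ?_
      rw [← Finset.mul_sum, Finset.sum_comm]
      exact mul_le_mul' le_rfl (Finset.sum_le_sum fun τ _ => sum_avgEnergy_fiber_le _ _ _ _ _)
    unfold boxSum
    rw [← ENNReal.tsum_mul_left, ← ENNReal.tsum_mul_left]
    refine (ENNReal.tsum_le_tsum fun s' : dyadicScales (σ ^ 2 * r₃) => hterm s' s'.2).trans ?_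
    rw [ENNReal.tsum_mul_left]
    gcongr
    -- Distinct `s'` give distinct `σs'`, so the sum over `s'` is part of the sum over `t`.
    have hinj : Function.Injective fun s' : dyadicScales (σ ^ 2 * r₃) =>
        (⟨σ * s', hscale s' s'.2⟩ : dyadicScales r₃) := by
      intro a b hab
      have := congrArg Subtype.val hab
      exact Subtype.ext (mul_left_cancel₀ hσ0.ne' this)
    exact ENNReal.tsum_comp_le_tsum_of_injective hinj fun t : dyadicScales r₃ => E t
  set SUP := ⨆ s ∈ dyadicScales r₂, SK K (s ^ 2 * r₂) (s ^ 2 * r₃) with hSUP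
  have hsup : SK K (σ ^ 2 * r₂) (σ ^ 2 * r₃) ≤ SUP :=
    le_iSup₂ (f := fun s (_ : s ∈ dyadicScales r₂) => SK K (s ^ 2 * r₂) (s ^ 2 * r₃)) σ hσ
  calc d₁ * avgEnergy (boxMap η s r₂) 1 S
      ≤ d₁ * (cmpConst 16 * (d₂ * avgEnergy (boxMap 0 1 (σ ^ 2 * r₂)) 1
          (sqDensity (sectorCenters (aperture r₂)) fun c' =>
            ∑ θ ∈ J with c θ = c', h' θ))) := by
        rw [e2]
        gcongr
    _ ≤ d₁ * (cmpConst 16 * (d₂ * ((multConst ^ 3 * gridConst : ℕ) * SUP *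
          ∑ i ∈ Finset.range multConst, boxSum (σ ^ 2 * r₃)
            (fun c' => ∑ θ ∈ J' i with c₂ θ = c', h' θ) par₃))) := by
        gcongr
        exact hmain.trans (by gcongr)
    _ = cmpConst 16 * (multConst ^ 3 * gridConst : ℕ) * SUP *
          ∑ i ∈ Finset.range multConst, d₁ * (d₂ * boxSum (σ ^ 2 * r₃)
            (fun c' => ∑ θ ∈ J' i with c₂ θ = c', h' θ) par₃) := by
        rw [← Finset.mul_sum, ← Finset.mul_sum]
        ring
    _ ≤ cmpConst 16 * (multConst ^ 3 * gridConst : ℕ) * SUP *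
          ∑ _i ∈ Finset.range multConst,
            (gridConst * multConst ^ 2 * (multConst * cmpConst 64) : ℕ) *
              ∑' t : dyadicScales r₃, E t :=
        mul_le_mul' le_rfl (Finset.sum_le_sum fun i _ => hbox i)
    _ = _ := by
        rw [Finset.sum_const, Finset.card_range, nsmul_eq_mul, sectorConst]
        push_cast
        ring

/-- The second step, summed over all sectors of all apertures. -/
lemma boxSum_regrouped_le {K r₂ r₃ : ℝ} (hK : 10 ≤ K) (h2 : 1 ≤ r₂) (h23 : r₂ ≤ r₃)
    {par par₂ : ℝ → ℝ → ℝ} (hpar : IsSectorAssignment K r₃ par)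
    (hpar₂ : IsSectorAssignment K r₂ par₂) (g : ℝ → 𝓢(E3, ℂ))
    (hg : ∀ θ ∈ sectorCenters (aperture r₃),
      tsupport (𝓕 (g θ) : 𝓢(E3, ℂ)) ⊆ sector K θ (aperture r₃)) (J : Finset ℝ)
    (hJ : J ⊆ sectorCenters (aperture r₃)) (c : ℝ → ℝ)
    (hc : ∀ θ ∈ J, c θ ∈ sectorCenters (aperture r₂) ∧ |θ / 2 - c θ| ≤ aperture r₂) :
    absDet (lorentzT 0 2 two_ne_zero).toLinearEquiv *
      boxSum r₂ (fun c' => ∑ θ ∈ J with c θ = c', compLorentz 0 2 two_ne_zero (g θ)) par₂ ≤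
      (gridConst * sectorConst * gridConst : ℕ) * ENNReal.ofReal (1 + Real.log r₂) *
        (⨆ s ∈ dyadicScales r₂, SK K (s ^ 2 * r₂) (s ^ 2 * r₃)) * boxSum r₃ g par := by
  have h3 : 1 ≤ r₃ := h2.trans h23
  set d := absDet (lorentzT 0 2 two_ne_zero).toLinearEquiv with hd
  set SUP := ⨆ s ∈ dyadicScales r₂, SK K (s ^ 2 * r₂) (s ^ 2 * r₃) with hSUP
  set h : ℝ → 𝓢(E3, ℂ) := fun θ => compLorentz 0 2 two_ne_zero (g θ) with hh
  set G : ℝ → 𝓢(E3, ℂ) := fun c' => ∑ θ ∈ J with c θ = c', h θ with hG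
  have hs : ∀ s ∈ dyadicScales r₂, d * ∑ η ∈ sectorCenters s,
      ∑' k, normalizedL2 (tileU η s r₂ k) (boxSquareFn r₂ G par₂ s η) ≤
      (gridConst * sectorConst * gridConst : ℕ) * SUP * boxSum r₃ g par := by
    intro s hs
    have hs0 := mem_dyadicScales_pos hs
    have hs1 := mem_dyadicScales_le_one hs
    have hη : ∀ η ∈ sectorCenters s,
        d * ∑' k, normalizedL2 (tileU η s r₂ k) (boxSquareFn r₂ G par₂ s η) ≤
        gridConst * (sectorConst * SUP * ∑' t : dyadicScales r₃, ∑ τ ∈ sectorCenters (t : ℝ),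
          avgEnergy (boxMap τ t r₃) 1 (sqDensity ((J.filter fun θ => par t θ = τ).filter
            fun θ => par₂ s (c θ) = η) g)) := by
      intro η hη
      have hη1 := abs_le_one_of_mem_sectorCenters hs0 hs1 hη
      have f1 := tsum_tileU_le (children r₂ par₂ s η) G hs0 hs1 (by linarith : 0 < r₂) hη1
      -- On the centres assigned to `η`, restricting the family to `θ` with this label changes no
      -- piece.
      have f2 : ∀ x, sqDensity (children r₂ par₂ s η) G x ≤
          sqDensity (sectorCenters (aperture r₂)) (fun c' =>
            ∑ θ ∈ (J.filter fun θ => par₂ s (c θ) = η) with c θ = c', h θ) x := by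
        intro x
        refine le_trans (le_of_eq ?_) 
          (sqDensity_mono (Finset.filter_subset (fun c' => par₂ s c' = η) _) _ x)
        refine Finset.sum_congr rfl fun c' hc' => ?_
        have e : (J.filter fun θ => c θ = c') =
            (J.filter fun θ => par₂ s (c θ) = η).filter fun θ => c θ = c' := by
          ext θ
          have := (Finset.mem_filter.1 hc').2
          simp only [Finset.mem_filter]
          constructor
          · rintro ⟨h1, rfl⟩
            exact ⟨⟨h1, this⟩, rfl⟩
          · rintro ⟨⟨h1, -⟩, h2⟩
            exact ⟨h1, h2⟩
        rw [hG]
        simp only [e]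
      have f3 := avgEnergy_sector_le hK h2 h23 hpar g hg hs hη1
        (J.filter fun θ => par₂ s (c θ) = η) ((Finset.filter_subset _ _).trans hJ) c (by
          intro θ hθ
          obtain ⟨hθJ, rfl⟩ := Finset.mem_filter.1 hθ
          exact ⟨(hc θ hθJ).1, (hc θ hθJ).2,
            abs_sub_le_of_assignment hK h2 hpar₂ hs.2 hs1 (hc θ hθJ).1⟩)
      calc _ ≤ d * (gridConst * avgEnergy (boxMap η s r₂) 1
            (sqDensity (sectorCenters (aperture r₂)) (fun c' =>
              ∑ θ ∈ (J.filter fun θ => par₂ s (c θ) = η) with c θ = c', h θ))) :=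
            mul_le_mul' le_rfl (f1.trans (mul_le_mul' le_rfl (avgEnergy_mono _ _ f2)))
        _ = gridConst * (d * avgEnergy (boxMap η s r₂) 1
            (sqDensity (sectorCenters (aperture r₂)) (fun c' =>
              ∑ θ ∈ (J.filter fun θ => par₂ s (c θ) = η) with c θ = c', h θ))) := by ring
        _ ≤ _ := by
            refine mul_le_mul' le_rfl (f3.trans_eq ?_)
            simp_rw [Finset.filter_comm (p := fun θ => par₂ s (c θ) = η)]
            rfl
    -- For fixed `t` and `τ` the subfamilies belonging to different `η` are disjoint, so the number
    -- of sectors of aperture `s` does not enter.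
    have hfinal : ∑ η ∈ sectorCenters s, ∑' t : dyadicScales r₃, ∑ τ ∈ sectorCenters (t : ℝ),
        avgEnergy (boxMap τ t r₃) 1 (sqDensity ((J.filter fun θ => par t θ = τ).filter
          fun θ => par₂ s (c θ) = η) g) ≤ gridConst * boxSum r₃ g par := by
      rw [← Summable.tsum_finsetSum (fun _ _ => ENNReal.summable), boxSum, ← ENNReal.tsum_mul_left]
      refine ENNReal.tsum_le_tsum fun t => ?_
      have ht0 := mem_dyadicScales_pos t.2
      have ht1 := mem_dyadicScales_le_one t.2
      rw [Finset.sum_comm, Finset.mul_sum]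
      refine Finset.sum_le_sum fun τ hτ => ?_
      refine (sum_avgEnergy_fiber_le _ _ _ _ _).trans ?_
      refine (avgEnergy_mono _ _ (T := sqDensity (children r₃ par t τ) g) fun x =>
        sqDensity_mono (Finset.filter_subset_filter _ hJ) g x).trans ?_
      exact avgEnergy_le_tsum_tileU _ _ ht0 ht1 (by linarith)
        (abs_le_one_of_mem_sectorCenters ht0 ht1 hτ)
    rw [Finset.mul_sum]
    refine (Finset.sum_le_sum hη).trans ?_
    rw [← Finset.mul_sum, ← Finset.mul_sum]
    refine (mul_le_mul' le_rfl (mul_le_mul' le_rfl hfinal)).trans (le_of_eq ?_)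
    push_cast
    ring
  -- The bound is the same for every `s`. Counting the scales is the only source of the logarithm.
  have hsum := tsum_dyadicScales_le h2 (fun s => d * ∑ η ∈ sectorCenters s,
    ∑' k, normalizedL2 (tileU η s r₂ k) (boxSquareFn r₂ G par₂ s η)) _ hs
  rw [ENNReal.tsum_mul_left] at hsum
  refine hsum.trans (le_of_eq ?_)
  ring

theorem lemma3p3 :
    ∃ C : ℝ≥0, ∀ K r₁ r₂ r₃ : ℝ, 10 ≤ K → 1 ≤ r₁ → r₁ < r₂ → r₂ ≤ r₃ →
      SK K r₁ r₃ ≤ (C : ℝ≥0∞) * ENNReal.ofReal (1 + Real.log r₂) * SK K r₁ r₂ *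
        ⨆ s ∈ dyadicScales r₂, SK K (s ^ 2 * r₂) (s ^ 2 * r₃) := by
  refine ⟨((gridConst * cmpConst 4 * (multConst ^ 3 * gridConst) *
    (multConst * (gridConst * sectorConst * gridConst)) : ℕ) : ℝ≥0), ?_⟩
  intro K r₁ r₂ r₃ hK h1 h12 h23
  have h2 : 1 ≤ r₂ := h1.trans h12.le
  refine sInf_le fun f g par _ hdec hpar => ?_
  -- Any assignment at scale `r₂` serves, because its disagreement with `par` is absorbed by the
  -- regrouping.
  obtain ⟨par₂, hpar₂⟩ := exists_isSectorAssignment hK h2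
  obtain ⟨J, c, hJ, hc, hmain⟩ := ballSum_le_sum_boxSum hK h1 h12 h23 hpar hpar₂ g hdec.1
  refine hmain.trans ?_
  refine (mul_le_mul' le_rfl (Finset.sum_le_sum fun i _ =>
    boxSum_regrouped_le hK h2 h23 hpar hpar₂ g hdec.1 (J i) (hJ i) c
      fun θ hθ => hc θ (hJ i hθ))).trans (le_of_eq ?_)
  rw [Finset.sum_const, Finset.card_range, nsmul_eq_mul, ENNReal.coe_natCast]
  push_cast
  ring
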